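/- For $n\ge 1$ let $\mathfrak S_n$ be the set of permutations of $[n]=\{1,\dots,n\}$. For $\sigma\in\mathfrak S_n$ and $I=\{i_1<\dots<i_k\}\subseteq[n]$, let $\mathrm{pat}_I(\sigma)\in\mathfrak S_k$ be the permutation whose values are in the same relative order as $\sigma(i_1),\dots,\sigma(i_k)$. A sequence $(\rho_n)_{n\ge1}$ of random permutations, with $\rho_n\in\mathfrak S_n$ (possibly defined on different probability spaces), is called *consistent* if for all $n\ge k\ge1$ one has $\mathrm{pat}_{I_{n,k}}(\rho_n)\stackrel d=\rho_k$, where $I_{n,k}$ is a uniform random subset of $[n]$ of size $k$, independent of $\rho_n$. A *permuton* is a probability measure on $[0,1]^2$ whose two marginals are both the Lebesgue measure on $[0,1]$. The set $\mathcal M$ of permutons carries the topology of weak convergence and its Borel $\sigma$-algebra, and a random permuton is a random variable with values in $\mathcal M$. For $\sigma\in\mathfrak S_n$, $n\ge1$, let $\mu_\sigma$ be the permuton with density $n\,\mathbf 1_{\sigma(\lceil nx\rceil)=\lceil ny\rceil}$ with respect to $dx\,dy$. For points $(x_1,y_1),\dots,(x_k,y_k)\in[0,1]^2$ with distinct $x_i$'s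 and distinct $y_i$'s, let $\mathrm{Perm}(\vec x,\vec y)\in\mathfrak S_k$ be the permutation whose values are in the same relative order as the $y$-coordinates of the points listed by increasing $x$-coordinate. For a random permuton $\boldsymbol\mu$, let $\mathrm{Perm}(\vec{\mathbf m}_k,\boldsymbol\mu)$ be the random permutation $\mathrm{Perm}(\vec x,\vec y)$ obtained from a vector $\vec{\mathbf m}_k$ of $k$ points that, conditionally on $\boldsymbol\mu$, are independent with common distribution $\boldsymbol\mu$ (the coordinates are then almost surely distinct). 1. If $\boldsymbol\mu$ is a random permuton, then every family of random permutations $(\rho_k)_{k\ge1}$ with $\rho_k\stackrel d=\mathrm{Perm}(\vec{\mathbf m}_k,\boldsymbol\mu)$ for all $k\ge1$ is consistent. 2. Conversely, for every consistent family of random permutations $(\rho_k)_{k\ge1}$ there exists a random permuton $\boldsymbol\mu$ such that $\mathrm{Perm}(\vec{\mathbf m}_k,\boldsymbol\mu)\stackrel d=\rho_k$ for all $k\ge1$, and the distribution of such a $\boldsymbol\mu$ is uniquely determined. 3. In that case, $\mu_{\rho_n}$ converges in distribution to $\boldsymbol\mu$ in $\mathcal M$ as $n\to\infty$. -/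

import Mathlib

open MeasureTheory ProbabilityTheory Filter Topology Set unitInterval
open scoped ENNReal

universe u v w

/-! ### Permutations of size `n`, relative order and patterns -/

/-- The set of permutations of size `n` is finite and carries the discrete σ-algebra. -/
instance permMeasurableSpace (n : ℕ) : MeasurableSpace (Equiv.Perm (Fin n)) := ⊤

/-- The permutation whose values are in the same relative order as `f 0, f 1, …, f (k-1)`: it maps
`i` to the rank of `f i`. (Ties, if any, are broken from left to right.) -/
def relOrder {α : Type*} [LinearOrder α] {k : ℕ} (f : Fin k → α) : Equiv.Perm (Fin k) :=
  (Tuple.sort f).symm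

/-- For an injective sequence, `relOrder f` has the same relative order as `f`. -/
theorem relOrder_lt_iff {α : Type*} [LinearOrder α] {k : ℕ} {f : Fin k → α}
    (hf : Function.Injective f) (i j : Fin k) : relOrder f i < relOrder f j ↔ f i < f j := by
  have h : StrictMono (f ∘ Tuple.sort f) :=
    (Tuple.monotone_sort f).strictMono_of_injective (hf.comp (Tuple.sort f).injective)
  have h2 := h.lt_iff_lt (a := relOrder f i) (b := relOrder f j)
  simpa [relOrder] using h2.symm

/-- The pattern `pat_J(τ) ∈ 𝔖_k` induced by `τ ∈ 𝔖_n` on a set `J ⊆ [n]` of cardinality `k`. -/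
def pat {n k : ℕ} (J : Set.powersetCard (Fin n) k) (τ : Equiv.Perm (Fin n)) :
    Equiv.Perm (Fin k) :=
  relOrder fun i : Fin k => τ (Finset.orderEmbOfFin J.1 J.2 i)

/-- `Perm(x⃗, y⃗)`: reorder the `k` points by increasing `x`-coordinate, and take the relative order
of the resulting sequence of `y`-coordinates. -/
noncomputable def inducedPerm {k : ℕ} (m : Fin k → I × I) : Equiv.Perm (Fin k) :=
  relOrder fun i : Fin k => (m (Tuple.sort (fun j => (m j).1) i)).2

/-! ### Permutons -/

/-- A permuton is a probability measure on the unit square whose two marginals are the Lebesgue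
measure on `[0,1]`. -/
def Permuton : Type :=
  {μ : ProbabilityMeasure (I × I) //
    (μ : Measure (I × I)).map Prod.fst = volume ∧ (μ : Measure (I × I)).map Prod.snd = volume}

namespace Permuton

/-- The underlying measure of a permuton. -/
def toMeasure (μ : Permuton) : Measure (I × I) := (μ.1 : Measure (I × I))

instance (μ : Permuton) : IsProbabilityMeasure μ.toMeasure :=
  inferInstanceAs (IsProbabilityMeasure (μ.1 : Measure (I × I)))

/-- The topology of weak convergence of measures. -/
noncomputable instance : TopologicalSpace Permuton :=
  TopologicalSpace.induced Subtype.val (inferInstance : TopologicalSpace (ProbabilityMeasure (I × I)))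

/-- The Borel σ-algebra of the topology of weak convergence. -/
noncomputable instance : MeasurableSpace Permuton := borel Permuton

instance : BorelSpace Permuton := ⟨rfl⟩

theorem measurable_toMeasure : Measurable toMeasure := by
  refine Measurable.measure_of_isPiSystem_of_isProbabilityMeasure
    (borel_eq_generateFrom_isClosed (α := I × I) ▸ BorelSpace.measurable_eq) isPiSystem_isClosed ?_
  intro F hF
  have key : ∀ μ : Permuton, Tendsto (fun n => ∫⁻ x, (hF.apprSeq n x : ℝ≥0∞) ∂μ.toMeasure) atTop
      (𝓝 (μ.toMeasure F)) := fun μ => HasOuterApproxClosed.tendsto_lintegral_apprSeq hF μ.toMeasure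
  refine measurable_of_tendsto_metrizable (f := fun n (μ : Permuton) =>
    ∫⁻ x, (hF.apprSeq n x : ℝ≥0∞) ∂μ.toMeasure) (fun n => ?_) (tendsto_pi_nhds.2 key)
  exact ((ProbabilityMeasure.continuous_lintegral_boundedContinuousFunction
    (hF.apprSeq n)).comp continuous_induced_dom).measurable

/-- The kernel that sends a permuton `μ` to the law `μ^{⊗k}` of `k` independent points with common
distribution `μ`. -/
noncomputable def iidKernel (k : ℕ) : Kernel Permuton (Fin k → I × I) where
  toFun μ := Measure.pi fun _ => μ.toMeasure
  measurable' := by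
    refine Measurable.measure_of_isPiSystem_of_isProbabilityMeasure generateFrom_pi.symm
      isPiSystem_pi ?_
    rintro _ ⟨s, hs, rfl⟩
    simp only [Measure.pi_pi]
    exact Finset.measurable_prod _ fun i _ =>
      (Measure.measurable_coe (show MeasurableSet (s i) from hs i (mem_univ i))).comp
        measurable_toMeasure

instance (k : ℕ) : IsMarkovKernel (iidKernel k) :=
  ⟨fun μ => inferInstanceAs (IsProbabilityMeasure (Measure.pi fun _ => μ.toMeasure))⟩

/-- The joint law of a random permuton `μ` (defined on the probability space `(Ω, P)`) and of `k`
points which, conditionally on `μ`, are independent with common distribution `μ`. -/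
noncomputable def sampleLaw {Ω : Type*} [MeasurableSpace Ω] (P : Measure Ω) (μ : Ω → Permuton)
    (k : ℕ) : Measure (Permuton × (Fin k → I × I)) :=
  (P.map μ) ⊗ₘ (iidKernel k)

/-- The strip of the points `x` of `[0,1]` such that `⌈n x⌉` is the `i`-th element of `[n]`, which
is `i + 1` since `Fin n` starts at `0`. -/
def strip (n : ℕ) (i : Fin n) : Set I := {x | ⌈(n : ℝ) * (x : ℝ)⌉₊ = (i : ℕ) + 1}

/-- The support `{(x, y) : τ(⌈n x⌉) = ⌈n y⌉}` of the permuton of a permutation `τ` of size `n`. -/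
def permSupport {n : ℕ} (τ : Equiv.Perm (Fin n)) : Set (I × I) :=
  {p | ∃ i : Fin n, p.1 ∈ strip n i ∧ p.2 ∈ strip n (τ i)}

theorem measurableSet_strip (n : ℕ) (i : Fin n) : MeasurableSet (strip n i) := by
  have : Measurable fun x : I => ⌈(n : ℝ) * (x : ℝ)⌉₊ :=
    Nat.measurable_ceil.comp (measurable_subtype_coe.const_mul _)
  exact this (measurableSet_singleton _)

theorem permSupport_eq {n : ℕ} (τ : Equiv.Perm (Fin n)) :
    permSupport τ = ⋃ i, strip n i ×ˢ strip n (τ i) := by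
  ext p; simp [permSupport]

theorem measurableSet_permSupport {n : ℕ} (τ : Equiv.Perm (Fin n)) :
    MeasurableSet (permSupport τ) := by
  rw [permSupport_eq]
  exact .iUnion fun i => (measurableSet_strip n i).prod (measurableSet_strip n _)

theorem disjoint_strip {n : ℕ} {i j : Fin n} (h : i ≠ j) : Disjoint (strip n i) (strip n j) := by
  rw [Set.disjoint_left]
  intro x hx hy
  simp only [strip, mem_ofPred_eq] at hx hy
  exact h (Fin.ext (by omega))

theorem volume_strip {n : ℕ} (i : Fin n) : volume (strip n i) = (n : ℝ≥0∞)⁻¹ := by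
  have hn : (0 : ℝ) < n := by exact_mod_cast i.pos
  have hi : ((i : ℕ) : ℝ) + 1 ≤ n := by exact_mod_cast i.isLt
  have h0 : ((i : ℕ) : ℝ) / n ∈ I := ⟨by positivity, by rw [div_le_one hn]; linarith⟩
  have h1 : (((i : ℕ) : ℝ) + 1) / n ∈ I := ⟨by positivity, by rw [div_le_one hn]; linarith⟩
  have : strip n i = Ioc (⟨_, h0⟩ : I) ⟨_, h1⟩ := by
    ext x
    simp only [strip, mem_ofPred_eq, mem_Ioc, ← Subtype.coe_lt_coe, ← Subtype.coe_le_coe]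
    rw [Nat.ceil_eq_iff (by omega), div_lt_iff₀ hn, le_div_iff₀ hn]
    push_cast [Nat.add_sub_cancel]
    rw [mul_comm (n : ℝ)]
  rw [this, unitInterval.volume_Ioc]
  simp only
  rw [← sub_div, add_sub_cancel_left, one_div, ENNReal.ofReal_inv_of_pos hn, ENNReal.ofReal_natCast]

theorem sum_volume_strip_inter {n : ℕ} [NeZero n] (A : Set I) (hA : MeasurableSet A) :
    ∑ i, volume (strip n i ∩ A) = volume A := by
  have hn : (0 : ℝ) < n := by exact_mod_cast Nat.pos_of_neZero n
  have h : volume (⋃ i, strip n i ∩ A) = ∑ i, volume (strip n i ∩ A) := by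
    rw [measure_iUnion (fun i j hij => (disjoint_strip hij).mono inter_subset_left inter_subset_left)
      (fun i => (measurableSet_strip n i).inter hA), tsum_fintype]
  rw [← h, ← iUnion_inter]
  refine le_antisymm (measure_mono inter_subset_right) ?_
  have h0 : volume ({0} : Set I) = 0 := by
    rw [← Icc_self, unitInterval.volume_Icc]; simp
  have hsub : A ⊆ ((⋃ i, strip n i) ∩ A) ∪ {0} := by
    intro x hx
    by_cases h : x = 0
    · exact Or.inr h
    · refine Or.inl ⟨?_, hx⟩
      have hx0 : (0 : ℝ) < x := unitInterval.pos_iff_ne_zero.2 h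
      have hc : 0 < ⌈(n : ℝ) * x⌉₊ := Nat.ceil_pos.2 (by positivity)
      have hc2 : ⌈(n : ℝ) * x⌉₊ ≤ n := Nat.ceil_le.2 (by nlinarith [x.2.2])
      exact mem_iUnion.2 ⟨⟨⌈(n : ℝ) * x⌉₊ - 1, by omega⟩, by
        simp only [strip, mem_ofPred_eq]; omega⟩
  calc volume A ≤ _ := measure_mono hsub
    _ ≤ _ := measure_union_le _ _
    _ = _ := by rw [h0, add_zero]

theorem volume_permSupport_inter {n : ℕ} (τ : Equiv.Perm (Fin n)) {A B : Set I}
    (hA : MeasurableSet A) (hB : MeasurableSet B) :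
    volume (permSupport τ ∩ A ×ˢ B) =
      ∑ i, volume (strip n i ∩ A) * volume (strip n (τ i) ∩ B) := by
  rw [permSupport_eq, iUnion_inter]
  simp only [prod_inter_prod]
  rw [measure_iUnion _ (fun i => ((measurableSet_strip n i).inter hA).prod
    ((measurableSet_strip n _).inter hB)), tsum_fintype]
  · simp only [Measure.volume_eq_prod, Measure.prod_prod]
  · intro i j hij
    exact Set.disjoint_prod.2
      (Or.inl ((disjoint_strip hij).mono inter_subset_left inter_subset_left))

/-- The measure `n 1_{τ(⌈n x⌉) = ⌈n y⌉} dx dy` on the unit square. -/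
noncomputable def permMeasure {n : ℕ} (τ : Equiv.Perm (Fin n)) : Measure (I × I) :=
  volume.withDensity ((permSupport τ).indicator fun _ => (n : ℝ≥0∞))

theorem permMeasure_prod {n : ℕ} (τ : Equiv.Perm (Fin n)) {A B : Set I}
    (hA : MeasurableSet A) (hB : MeasurableSet B) :
    permMeasure τ (A ×ˢ B) =
      n * ∑ i, volume (strip n i ∩ A) * volume (strip n (τ i) ∩ B) := by
  rw [permMeasure, withDensity_apply _ (hA.prod hB),
    lintegral_indicator_const (measurableSet_permSupport τ),
    Measure.restrict_apply (measurableSet_permSupport τ), volume_permSupport_inter τ hA hB]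

theorem permMeasure_map_fst {n : ℕ} [NeZero n] (τ : Equiv.Perm (Fin n)) :
    (permMeasure τ).map Prod.fst = volume := by
  ext A hA
  rw [Measure.map_apply measurable_fst hA, ← prod_univ, permMeasure_prod τ hA .univ]
  simp only [inter_univ, volume_strip]
  rw [← Finset.sum_mul, sum_volume_strip_inter A hA, mul_comm, mul_assoc,
    ENNReal.inv_mul_cancel (by simp [NeZero.ne n]) (by simp), mul_one]

theorem permMeasure_map_snd {n : ℕ} [NeZero n] (τ : Equiv.Perm (Fin n)) :
    (permMeasure τ).map Prod.snd = volume := by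
  ext A hA
  rw [Measure.map_apply measurable_snd hA, ← univ_prod, permMeasure_prod τ .univ hA]
  simp only [inter_univ, volume_strip]
  rw [← Finset.mul_sum, Equiv.sum_comp τ (fun i => volume (strip n i ∩ A)),
    sum_volume_strip_inter A hA, ← mul_assoc,
    ENNReal.mul_inv_cancel (by simp [NeZero.ne n]) (by simp), one_mul]

theorem isProbabilityMeasure_permMeasure {n : ℕ} [NeZero n] (τ : Equiv.Perm (Fin n)) :
    IsProbabilityMeasure (permMeasure τ) := by
  constructor
  rw [← preimage_univ (f := (Prod.fst : I × I → I)), ← Measure.map_apply measurable_fst .univ,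
    permMeasure_map_fst, measure_univ]

/-- The permuton `μ_τ` of a permutation `τ` of size `n ≥ 1`, with density
`n 1_{τ(⌈n x⌉) = ⌈n y⌉}`. -/
noncomputable def ofPerm {n : ℕ} [NeZero n] (τ : Equiv.Perm (Fin n)) : Permuton :=
  ⟨⟨permMeasure τ, isProbabilityMeasure_permMeasure τ⟩,
    permMeasure_map_fst τ, permMeasure_map_snd τ⟩

end Permuton

/-! ### Families of random permutations -/

/-- The family of random permutations `ρ n ∈ 𝔖_n`, `n ≥ 1` (where `ρ n` is defined on the
probability space `(Ω n, P n)`), is consistent: for all `n ≥ k ≥ 1`, if `J` is a uniform subset of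
`[n]` of size `k`, independent of `ρ n`, then `pat_J(ρ n)` has the same distribution as `ρ k`. -/
def IsConsistentFamily {Ω : ℕ+ → Type*} [∀ n, MeasurableSpace (Ω n)] (P : ∀ n, Measure (Ω n))
    (ρ : ∀ n : ℕ+, Ω n → Equiv.Perm (Fin n)) : Prop :=
  ∀ n k : ℕ+, k ≤ n →
    IdentDistrib (fun q : Set.powersetCard (Fin n) k × Ω n => pat q.1 (ρ n q.2)) (ρ k)
      ((uniformOn (Set.univ : Set (Set.powersetCard (Fin n) k))).prod (P n)) (P k)

/-- For every `k ≥ 1`, the random permutation `ρ k` has the same distribution as the subpermutation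
of size `k` induced by `k` points sampled from the random permuton `μ`. -/
def IsSampledFamily {Ω' : Type*} [MeasurableSpace Ω'] (Q : Measure Ω') (μ : Ω' → Permuton)
    {Ω : ℕ+ → Type*} [∀ n, MeasurableSpace (Ω n)] (P : ∀ n, Measure (Ω n))
    (ρ : ∀ n : ℕ+, Ω n → Equiv.Perm (Fin n)) : Prop :=
  ∀ k : ℕ+, IdentDistrib (fun q : Permuton × (Fin k → I × I) => inducedPerm q.2) (ρ k)
    (Permuton.sampleLaw Q μ k) (P k)

/-! ### Relative orders -/

/-! Everything is read off the expected pattern densities `∫⁻ ν, density π ν ∂Λ` of the law `Λ` of a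
random permuton. Sampling `n` points and keeping a uniform subset of `k` of them is the same as
sampling `k` points (`lintegral_patProportion`). This gives consistency of sampled families.

The expected densities determine `Λ`. The expectations of functions of the relative orders of
independent points form an algebra of functions of `ν`, since two independent samples can be
juxtaposed, and by exchangeability each is a linear combination of pattern densities. This algebra
separates permutons: because both marginals are uniform, the moment of `x ^ a * y ^ b` is the
probability that `a` further points lie to the left of an initial point and `b` others below it. A
separating algebra of bounded continuous functions determines probability measures on a Polish space
(`measure_ext_of_lintegral_density`).

For existence, permutons form a compact metrizable space, hence so do their laws, and the laws of
the permutons of `ρ n` converge along every ultrafilter. Densities are continuous because ties have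
probability zero. The density of `π` in the permuton of `s` is at least the proportion of `π` in `s`
times the probability that `k` points fall in distinct cells, which tends to `1`. By consistency the
expected proportion is `P k (ρ k ⁻¹' {π})`, so the limit densities dominate these numbers; as both
families sum to `1`, they agree. Uniqueness then identifies all ultrafilter limits, which is
convergence. -/

theorem relOrder_congr {α β : Type*} [LinearOrder α] [LinearOrder β] {k : ℕ} {f : Fin k → α}
    {g : Fin k → β} (h : ∀ i j, f i < f j ↔ g i < g j) : relOrder f = relOrder g := by
  have hle : ∀ i j, f i ≤ f j ↔ g i ≤ g j := fun i j => by
    rw [← not_lt, ← not_lt, h]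
  have heq : ∀ i j, f i = f j ↔ g i = g j := fun i j => by
    rw [le_antisymm_iff, le_antisymm_iff, hle, hle]
  have : Tuple.sort f = Tuple.sort g := by
    rw [Tuple.eq_sort_iff]
    obtain ⟨h1, h2⟩ := Tuple.eq_sort_iff.1 (rfl : Tuple.sort f = Tuple.sort f)
    exact ⟨fun i j hij => (hle _ _).1 (h1 hij), fun i j hij e => h2 i j hij ((heq _ _).2 e)⟩
  rw [relOrder, relOrder, this]

theorem relOrder_relOrder_comp {α : Type*} [LinearOrder α] {k l : ℕ} {f : Fin k → α}
    (hf : Function.Injective f) (e : Fin l → Fin k) :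
    relOrder (fun i => relOrder f (e i)) = relOrder fun i => f (e i) :=
  relOrder_congr fun _ _ => relOrder_lt_iff hf _ _

theorem comp_sort_strictMono {α : Type*} [LinearOrder α] {k : ℕ} {f : Fin k → α}
    (hf : Function.Injective f) : StrictMono fun i => f (Tuple.sort f i) :=
  (Tuple.monotone_sort f).strictMono_of_injective (hf.comp (Tuple.sort f).injective)

/-- The abscissas of the points are distinct, and so are their ordinates. -/
def DistinctCoords {k : ℕ} (m : Fin k → I × I) : Prop :=
  Function.Injective (fun i => (m i).1) ∧ Function.Injective (fun i => (m i).2)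

theorem DistinctCoords.comp {k l : ℕ} {m : Fin k → I × I} (hm : DistinctCoords m)
    {e : Fin l → Fin k} (he : Function.Injective e) : DistinctCoords fun i => m (e i) :=
  ⟨hm.1.comp he, hm.2.comp he⟩

theorem inducedPerm_of_strictMono {k : ℕ} {m : Fin k → I × I}
    (hm : StrictMono fun i => (m i).1) : inducedPerm m = relOrder fun i => (m i).2 := by
  have : Tuple.sort (fun i => (m i).1) = Equiv.refl _ :=
    Tuple.sort_eq_refl_iff_monotone.2 hm.monotone
  simp [inducedPerm, this]

/-- Sorting by abscissa forgets the labels; with distinct abscissas the sorted list of points is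
unique. -/
theorem inducedPerm_comp_perm {k : ℕ} {m : Fin k → I × I} (hm : DistinctCoords m)
    (τ : Equiv.Perm (Fin k)) : inducedPerm (fun i => m (τ i)) = inducedPerm m := by
  have h : ((fun i => (m i).1) ∘ τ) ∘ Tuple.sort ((fun i => (m i).1) ∘ τ) =
      (fun i => (m i).1) ∘ Tuple.sort (fun i => (m i).1) :=
    Tuple.comp_perm_comp_sort_eq_comp_sort
  have h' : ∀ i, τ (Tuple.sort (fun j => (m (τ j)).1) i) = Tuple.sort (fun j => (m j).1) i :=
    fun i => hm.1 (congrFun h i)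
  simp only [inducedPerm, h']

theorem relOrder_inducedPerm_comp {k l : ℕ} {m : Fin k → I × I} (hm : DistinctCoords m)
    (e : Fin l → Fin k) : relOrder (fun i => inducedPerm m (e i)) =
      relOrder fun i => (m (Tuple.sort (fun j => (m j).1) (e i))).2 :=
  relOrder_relOrder_comp (f := fun i => (m (Tuple.sort (fun j => (m j).1) i)).2)
    (hm.2.comp (Equiv.injective _)) e

/-- Taking a pattern of the permutation induced by points amounts to selecting some of them. -/
theorem pat_inducedPerm {n k : ℕ} {m : Fin n → I × I} (hm : DistinctCoords m)
    (J : Set.powersetCard (Fin n) k) : pat J (inducedPerm m) = inducedPerm fun i : Fin k =>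
      m (Tuple.sort (fun j => (m j).1) (Finset.orderEmbOfFin J.1 J.2 i)) := by
  rw [pat, relOrder_inducedPerm_comp hm, inducedPerm_of_strictMono]
  exact (comp_sort_strictMono hm.1).comp (Finset.orderEmbOfFin J.1 J.2).strictMono

/-! ### Injections as labelled subsets -/

/-- The injection with range `J` whose labelling is `τ`. -/
def labelledEmb {n k : ℕ} (p : Set.powersetCard (Fin n) k × Equiv.Perm (Fin k)) :
    Fin k ↪ Fin n :=
  p.2.toEmbedding.trans (Finset.orderEmbOfFin p.1.1 p.1.2).toEmbedding

@[simp] theorem labelledEmb_apply {n k : ℕ} (J : Set.powersetCard (Fin n) k)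
    (τ : Equiv.Perm (Fin k)) (i : Fin k) :
    labelledEmb (J, τ) i = Finset.orderEmbOfFin J.1 J.2 (τ i) := rfl

theorem range_labelledEmb {n k : ℕ} (p : Set.powersetCard (Fin n) k × Equiv.Perm (Fin k)) :
    Set.range (labelledEmb p) = (p.1.1 : Set (Fin n)) := by
  have : (labelledEmb p : Fin k → Fin n) = Finset.orderEmbOfFin p.1.1 p.1.2 ∘ p.2 := rfl
  rw [this, p.2.surjective.range_comp]
  exact Finset.range_orderEmbOfFin p.1.1 p.1.2

/-- An injection is recovered from its range and from the rank of each of its values. Ordered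
samples can thus be counted by subsets, each with `k!` labellings. -/
theorem labelledEmb_bijective {n k : ℕ} : Function.Bijective (labelledEmb (n := n) (k := k)) := by
  constructor
  · rintro ⟨J, τ⟩ ⟨J', τ'⟩ h
    have hJ : J = J' := by
      have := congrArg (fun e : Fin k ↪ Fin n => Set.range e) h
      simp only [range_labelledEmb] at this
      exact Subtype.ext (Finset.coe_injective this)
    subst hJ
    have : τ = τ' := by
      ext i : 1
      exact (Finset.orderEmbOfFin J.1 J.2).injective (DFunLike.congr_fun h i)
    rw [this]
  · intro e
    have hc : (Finset.univ.map e).card = k := by simp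
    have hmem : ∀ i, ∃ j, Finset.orderEmbOfFin (Finset.univ.map e) hc j = e i := by
      intro i
      have : e i ∈ Set.range (Finset.orderEmbOfFin (Finset.univ.map e) hc) := by
        rw [Finset.range_orderEmbOfFin]; simp
      exact this
    choose τ hτ using hmem
    have hinj : Function.Injective τ := fun i j hij => e.injective (by rw [← hτ, ← hτ, hij])
    refine ⟨(⟨Finset.univ.map e, hc⟩, Equiv.ofBijective τ (Finite.injective_iff_bijective.1 hinj)),
      ?_⟩
    ext i : 1
    exact hτ i

theorem sum_embedding_eq {n k : ℕ} {M : Type*} [AddCommMonoid M] (f : (Fin k ↪ Fin n) → M) :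
    ∑ e, f e = ∑ J : Set.powersetCard (Fin n) k, ∑ τ, f (labelledEmb (J, τ)) := by
  rw [← Fintype.sum_prod_type']
  exact (Fintype.sum_bijective _ labelledEmb_bijective _ _ fun _ => rfl).symm

theorem card_embedding_eq (n k : ℕ) :
    n.descFactorial k = Fintype.card (Set.powersetCard (Fin n) k) * k.factorial := by
  have := sum_embedding_eq (n := n) (k := k) (fun _ => 1)
  simpa [Fintype.card_embedding_eq, Fintype.card_perm] using this

/-! ### Measurability -/

instance (n : ℕ) : DiscreteMeasurableSpace (Equiv.Perm (Fin n)) := ⟨fun _ => trivial⟩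

/-- `Tuple.eq_sort_iff` describes the sorting permutation, ties included, by finitely many
comparisons of coordinates. -/
theorem measurable_sort {α : Type*} [MeasurableSpace α] {k : ℕ} {f : α → Fin k → I}
    (hf : ∀ i, Measurable fun a => f a i) (s : Equiv.Perm (Fin k)) :
    MeasurableSet {a | Tuple.sort (f a) = s} := by
  have : {a | Tuple.sort (f a) = s} = ⋂ i, ⋂ j, {a | (i ≤ j → f a (s i) ≤ f a (s j)) ∧
      (i < j → f a (s i) = f a (s j) → s i < s j)} := by
    ext a
    simp only [mem_ofPred_eq, mem_iInter]
    rw [eq_comm, Tuple.eq_sort_iff]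
    constructor
    · rintro ⟨h1, h2⟩ i j
      exact ⟨fun h => h1 h, h2 i j⟩
    · intro h
      exact ⟨fun i j hij => (h i j).1 hij, fun i j => (h i j).2⟩
  rw [this]
  refine .iInter fun i => .iInter fun j => ?_
  have hle : MeasurableSet {a | f a (s i) ≤ f a (s j)} := measurableSet_le (hf _) (hf _)
  have heq : MeasurableSet {a | f a (s i) = f a (s j)} := measurableSet_eq_fun (hf _) (hf _)
  refine MeasurableSet.inter ?_ ?_
  · exact (MeasurableSet.const _).imp hle
  · exact (MeasurableSet.const _).imp (heq.imp (.const _))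

theorem measurable_relOrder {α : Type*} [MeasurableSpace α] {k : ℕ} {f : α → Fin k → I}
    (hf : ∀ i, Measurable fun a => f a i) : Measurable fun a => relOrder (f a) := by
  refine measurable_to_countable' fun s => ?_
  have : (fun a => relOrder (f a)) ⁻¹' {s} = {a | Tuple.sort (f a) = s.symm} := by
    ext a
    simp only [relOrder, mem_preimage, mem_singleton_iff, mem_ofPred_eq]
    exact ⟨fun h => by rw [← h, Equiv.symm_symm], fun h => by rw [h, Equiv.symm_symm]⟩
  rw [this]
  exact measurable_sort hf _

theorem measurable_inducedPerm {k : ℕ} :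
    Measurable (inducedPerm : (Fin k → I × I) → Equiv.Perm (Fin k)) := by
  refine measurable_to_countable' fun π => ?_
  have : (inducedPerm : (Fin k → I × I) → Equiv.Perm (Fin k)) ⁻¹' {π} =
      ⋃ s : Equiv.Perm (Fin k), {m | Tuple.sort (fun j => (m j).1) = s} ∩
        {m | relOrder (fun i => (m (s i)).2) = π} := by
    ext m
    simp [inducedPerm]
  rw [this]
  refine .iUnion fun s => (measurable_sort (fun i => by fun_prop) s).inter ?_
  exact (measurable_relOrder (α := Fin k → I × I) (f := fun m i => (m (s i)).2)
    (fun i => by fun_prop)) (measurableSet_singleton π)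

/-! ### Independent points with a common distribution -/

section iid

variable {α : Type*} [MeasurableSpace α]

theorem pi_map_comp_injective (ν : Measure α) [IsProbabilityMeasure ν] {ι κ : Type*} [Fintype ι]
    [Fintype κ] {e : κ → ι} (he : Function.Injective e) :
    (Measure.pi fun _ : ι => ν).map (fun m i => m (e i)) = Measure.pi fun _ : κ => ν := by
  classical
  refine (Measure.pi_eq fun s hs => ?_).symm
  rw [Measure.map_apply (by fun_prop) (.univ_pi hs)]
  -- The preimage of a box is a box: its factor is `s i` at `e i` and the whole space, of mass `1`,
  -- off the range of `e`.
  have : (fun (m : ι → α) (i : κ) => m (e i)) ⁻¹' univ.pi s =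
      univ.pi fun j => ⋂ i, ⋂ _ : e i = j, s i := by
    ext m
    simp only [mem_preimage, mem_univ_pi, mem_iInter]
    exact ⟨fun h j i hij => hij ▸ h i, fun h i => h _ i rfl⟩
  rw [this, Measure.pi_pi, ← Finset.prod_subset (Finset.subset_univ (Finset.univ.map ⟨e, he⟩)),
    Finset.prod_map]
  · refine Finset.prod_congr rfl fun i _ => ?_
    congr 1
    ext x
    simp only [Function.Embedding.coeFn_mk, mem_iInter]
    exact ⟨fun h => h i rfl, fun h j hj => he hj ▸ h⟩
  · intro j _ hj
    have : (⋂ i, ⋂ _ : e i = j, s i) = univ := by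
      refine eq_univ_of_forall fun x => ?_
      simp only [mem_iInter]
      rintro i rfl
      exact absurd (by simp) hj
    rw [this, measure_univ]

theorem measurable_append {k l : ℕ} :
    Measurable fun p : (Fin k → α) × (Fin l → α) => Fin.append p.1 p.2 := by
  refine measurable_pi_lambda _ fun i => ?_
  refine Fin.addCases (fun i => ?_) (fun i => ?_) i
  · simp only [Fin.append_left]; fun_prop
  · simp only [Fin.append_right]; fun_prop

theorem prod_map_append (ν : Measure α) [IsProbabilityMeasure ν] (k l : ℕ) :
    ((Measure.pi fun _ : Fin k => ν).prod (Measure.pi fun _ : Fin l => ν)).map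
      (fun p => Fin.append p.1 p.2) = Measure.pi fun _ : Fin (k + l) => ν := by
  refine (Measure.pi_eq fun s hs => ?_).symm
  rw [Measure.map_apply measurable_append (.univ_pi hs)]
  have : (fun p : (Fin k → α) × (Fin l → α) => Fin.append p.1 p.2) ⁻¹' univ.pi s =
      (univ.pi fun i => s (Fin.castAdd l i)) ×ˢ univ.pi fun i => s (Fin.natAdd k i) := by
    ext p
    simp [Fin.forall_fin_add]
  rw [this, Measure.prod_prod, Measure.pi_pi, Measure.pi_pi, Fin.prod_univ_add]

theorem measurable_cons {k : ℕ} :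
    Measurable fun p : α × (Fin k → α) => (Fin.cons p.1 p.2 : Fin (k + 1) → α) := by
  refine measurable_pi_lambda _ fun i => ?_
  refine Fin.cases ?_ (fun i => ?_) i
  · simp only [Fin.cons_zero]; fun_prop
  · simp only [Fin.cons_succ]; fun_prop

theorem prod_map_cons (ν : Measure α) [IsProbabilityMeasure ν] (k : ℕ) :
    (ν.prod (Measure.pi fun _ : Fin k => ν)).map
      (fun p => (Fin.cons p.1 p.2 : Fin (k + 1) → α)) = Measure.pi fun _ : Fin (k + 1) => ν := by
  refine (Measure.pi_eq fun s hs => ?_).symm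
  rw [Measure.map_apply measurable_cons (.univ_pi hs)]
  have : (fun p : α × (Fin k → α) => (Fin.cons p.1 p.2 : Fin (k + 1) → α)) ⁻¹' univ.pi s =
      s 0 ×ˢ univ.pi fun i => s (Fin.succ i) := by
    ext p
    simp [Fin.forall_fin_succ]
  rw [this, Measure.prod_prod, Measure.pi_pi, Fin.prod_univ_succ]

/-- By Fubini: once the first point is fixed, a coincidence confines the second to a null fibre of
`f`. -/
theorem ae_ne_of_nullSingletonClass {β : Type*} [MeasurableSpace β] [MeasurableEq β] (ν : Measure α)
    [IsProbabilityMeasure ν] {f : α → β} (hf : Measurable f) [NullSingletonClass (ν.map f)] :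
    ∀ᵐ p ∂ν.prod ν, f p.1 ≠ f p.2 := by
  have hm : MeasurableSet {p : α × α | f p.1 ≠ f p.2} :=
    (measurableSet_eq_fun (by fun_prop) (by fun_prop)).compl
  rw [Measure.ae_prod_iff_ae_ae hm]
  refine ae_of_all _ fun x => ?_
  have h0 := measure_singleton (μ := ν.map f) (f x)
  have : {y | ¬ f x ≠ f y} = f ⁻¹' {f x} := by
    ext y; simp [eq_comm]
  rw [ae_iff, this]
  exact le_antisymm (le_trans (Measure.le_map_apply hf.aemeasurable _) h0.le) bot_le

theorem pi_ae_injective {β : Type*} [MeasurableSpace β] [MeasurableEq β] (ν : Measure α)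
    [IsProbabilityMeasure ν] {f : α → β} (hf : Measurable f) [NullSingletonClass (ν.map f)] (k : ℕ) :
    ∀ᵐ m ∂(Measure.pi fun _ : Fin k => ν), Function.Injective fun i => f (m i) := by
  have key : ∀ i j : Fin k, i ≠ j → ∀ᵐ m ∂(Measure.pi fun _ : Fin k => ν), f (m i) ≠ f (m j) := by
    intro i j hij
    have he : Function.Injective ![i, j] := by
      intro a b; fin_cases a <;> fin_cases b <;> simp [hij, hij.symm]
    have h1 := (measurePreserving_finTwoArrow ν).map_eq
    have h2 := ae_ne_of_nullSingletonClass ν hf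
    rw [← h1] at h2
    have h3 := ae_of_ae_map (MeasurableEquiv.measurable _).aemeasurable h2
    rw [← pi_map_comp_injective ν he] at h3
    have h4 := ae_of_ae_map (measurable_pi_lambda _ fun a =>
      measurable_pi_apply (![i, j] a)).aemeasurable h3
    filter_upwards [h4] with m hm
    simpa using hm
  have : ∀ᵐ m ∂(Measure.pi fun _ : Fin k => ν), ∀ i j, i ≠ j → f (m i) ≠ f (m j) := by
    simp only [ae_all_iff]
    exact key
  filter_upwards [this] with m hm i j hij
  by_contra h
  exact hm i j h hij

end iid

namespace Permuton

theorem iidKernel_apply (k : ℕ) (ν : Permuton) :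
    iidKernel k ν = Measure.pi fun _ => ν.toMeasure := rfl

/-- Uniform marginals have no atoms. This makes the tie-breaking conventions of `relOrder` and
`inducedPerm` irrelevant almost surely. -/
theorem ae_distinctCoords (k : ℕ) (ν : Permuton) :
    ∀ᵐ m ∂iidKernel k ν, DistinctCoords m := by
  have h1 : NullSingletonClass (ν.toMeasure.map Prod.fst) := by
    rw [show ν.toMeasure.map Prod.fst = volume from ν.2.1]; infer_instance
  have h2 : NullSingletonClass (ν.toMeasure.map Prod.snd) := by
    rw [show ν.toMeasure.map Prod.snd = volume from ν.2.2]; infer_instance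
  rw [iidKernel_apply]
  filter_upwards [pi_ae_injective ν.toMeasure measurable_fst k,
    pi_ae_injective ν.toMeasure measurable_snd k] with m h1 h2
  exact ⟨h1, h2⟩

theorem iidKernel_map_comp {k l : ℕ} (ν : Permuton) {e : Fin l → Fin k}
    (he : Function.Injective e) :
    (iidKernel k ν).map (fun m i => m (e i)) = iidKernel l ν :=
  pi_map_comp_injective _ he

/-! ### The topology of the space of permutons -/

/-- The marginals depend continuously on the measure, so prescribing them is a closed condition.
Compactness and metrizability are inherited from the probability measures on the square. -/
theorem isClosedEmbedding_val : IsClosedEmbedding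
    (Subtype.val : Permuton → ProbabilityMeasure (I × I)) := by
  let c : ProbabilityMeasure I := ⟨volume, inferInstance⟩
  refine ⟨⟨⟨rfl⟩, Subtype.val_injective⟩, ?_⟩
  have h : range (Subtype.val : Permuton → ProbabilityMeasure (I × I)) =
      {μ | μ.map measurable_fst.aemeasurable = c} ∩
      {μ | μ.map measurable_snd.aemeasurable = c} := by
    ext μ
    constructor
    · rintro ⟨ν, rfl⟩
      exact ⟨Subtype.ext ν.2.1, Subtype.ext ν.2.2⟩
    · exact fun h => ⟨⟨μ, congrArg Subtype.val h.1, congrArg Subtype.val h.2⟩, rfl⟩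
  rw [h]
  exact (isClosed_eq (ProbabilityMeasure.continuous_map continuous_fst) continuous_const).inter
    (isClosed_eq (ProbabilityMeasure.continuous_map continuous_snd) continuous_const)

instance : CompactSpace Permuton := isClosedEmbedding_val.compactSpace

instance : TopologicalSpace.MetrizableSpace Permuton :=
  isClosedEmbedding_val.isEmbedding.metrizableSpace

instance : PolishSpace Permuton := by
  let := TopologicalSpace.metrizableSpaceMetric Permuton
  infer_instance

/-! ### Pattern densities -/

/-- The probability that `k` independent points with distribution `ν` induce the permutation
`π`. -/
noncomputable def density {k : ℕ} (π : Equiv.Perm (Fin k)) (ν : Permuton) : ℝ≥0∞ :=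
  iidKernel k ν (inducedPerm ⁻¹' {π})

theorem measurableSet_inducedPerm_eq {k : ℕ} (π : Equiv.Perm (Fin k)) :
    MeasurableSet (inducedPerm ⁻¹' {π} : Set (Fin k → I × I)) :=
  measurable_inducedPerm (measurableSet_singleton π)

theorem measurable_density {k : ℕ} (π : Equiv.Perm (Fin k)) : Measurable (density π) :=
  (iidKernel k).measurable_coe (measurableSet_inducedPerm_eq π)

theorem density_le_one {k : ℕ} (π : Equiv.Perm (Fin k)) (ν : Permuton) : density π ν ≤ 1 :=
  prob_le_one

theorem sum_density {k : ℕ} (ν : Permuton) : ∑ π : Equiv.Perm (Fin k), density π ν = 1 := by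
  have h := sum_measure_preimage_singleton (μ := iidKernel k ν)
    (f := (inducedPerm : (Fin k → I × I) → Equiv.Perm (Fin k))) Finset.univ
    (fun π _ => measurableSet_inducedPerm_eq π)
  simpa [density] using h

/-- Strict inequalities survive small perturbations, so both relative orders are locally constant
where there are no ties. -/
theorem isOpen_distinctCoords_and {k : ℕ} (p : Equiv.Perm (Fin k) → Equiv.Perm (Fin k) → Prop) :
    IsOpen {m : Fin k → I × I | DistinctCoords m ∧
      p (relOrder fun i => (m i).1) (relOrder fun i => (m i).2)} := by
  rw [isOpen_iff_mem_nhds]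
  rintro m ⟨hm, hp⟩
  have key : ∀ f : I × I → I, Continuous f → Function.Injective (fun i => f (m i)) →
      ∀ᶠ m' in 𝓝 m, ∀ i j, f (m i) < f (m j) → f (m' i) < f (m' j) := by
    intro f hf hinj
    simp only [eventually_all]
    intro i j hij
    have h1 : Continuous fun m' : Fin k → I × I => f (m' i) := by fun_prop
    have h2 : Continuous fun m' : Fin k → I × I => f (m' j) := by fun_prop
    exact (isOpen_lt h1 h2).mem_nhds hij
  have key2 : ∀ f g : Fin k → I, Function.Injective f → (∀ i j, f i < f j → g i < g j) →
      Function.Injective g ∧ relOrder f = relOrder g := by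
    intro f g hf h
    have hg : Function.Injective g := by
      intro i j hij
      by_contra hne
      rcases lt_or_gt_of_ne (hf.ne hne) with h' | h'
      · exact (h _ _ h').ne hij
      · exact (h _ _ h').ne' hij
    refine ⟨hg, relOrder_congr fun i j => ⟨h i j, fun h' => ?_⟩⟩
    by_contra hle
    rcases (not_lt.1 hle).lt_or_eq with h'' | h''
    · exact (h _ _ h'').not_gt h'
    · rw [hf h''] at h'; exact lt_irrefl _ h'
  filter_upwards [key _ continuous_fst hm.1, key _ continuous_snd hm.2] with m' h1 h2
  obtain ⟨i1, e1⟩ := key2 _ (fun i => (m' i).1) hm.1 h1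
  obtain ⟨i2, e2⟩ := key2 _ (fun i => (m' i).2) hm.2 h2
  exact ⟨⟨i1, i2⟩, by rw [← e1, ← e2]; exact hp⟩

/-- Product measures depend continuously on `ν`, and the frontier of an order event consists of
tuples with ties, a null set; the portmanteau theorem applies. -/
theorem continuous_iidKernel_orderEvent {k : ℕ}
    (p : Equiv.Perm (Fin k) → Equiv.Perm (Fin k) → Prop) :
    Continuous fun ν : Permuton => iidKernel k ν
      {m | p (relOrder fun i => (m i).1) (relOrder fun i => (m i).2)} := by
  rw [continuous_iff_continuousAt]
  intro ν
  have hc : Continuous fun ν : Permuton => ProbabilityMeasure.pi fun _ : Fin k => ν.1 :=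
    ProbabilityMeasure.continuous_pi.comp
      (continuous_pi fun _ => isClosedEmbedding_val.continuous)
  refine ProbabilityMeasure.tendsto_measure_of_null_frontier_of_tendsto' (hc.tendsto ν) ?_
  refine measure_mono_null ?_ (ae_iff.1 (ae_distinctCoords k ν))
  intro m hm
  by_contra hd
  simp only [mem_ofPred_eq, not_not] at hd
  have h1 : interior {m : Fin k → I × I |
      p (relOrder fun i => (m i).1) (relOrder fun i => (m i).2)} ⊇ _ :=
    interior_maximal (fun m hm => hm.2) (isOpen_distinctCoords_and p)
  have h2 := (isOpen_distinctCoords_and fun a b => ¬ p a b)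
  rw [frontier, Set.mem_sdiff, mem_closure_iff] at hm
  by_cases hp : p (relOrder fun i => (m i).1) (relOrder fun i => (m i).2)
  · exact hm.2 (h1 ⟨hd, hp⟩)
  · obtain ⟨m', h, h'⟩ := hm.1 _ h2 ⟨hd, hp⟩
    exact h.2 h'

/-! ### Statistics of the relative orders of independent points -/

/-- The value of a function of the relative orders of the abscissas and of the ordinates. -/
noncomputable def orderStat {k : ℕ} (h : Equiv.Perm (Fin k) → Equiv.Perm (Fin k) → ℝ)
    (m : Fin k → I × I) : ℝ :=
  h (relOrder fun i => (m i).1) (relOrder fun i => (m i).2)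

theorem measurable_relOrder_fst {k : ℕ} :
    Measurable fun m : Fin k → I × I => relOrder fun i => (m i).1 :=
  measurable_relOrder (α := Fin k → I × I) (f := fun m i => (m i).1) (fun i => by fun_prop)

theorem measurable_relOrder_snd {k : ℕ} :
    Measurable fun m : Fin k → I × I => relOrder fun i => (m i).2 :=
  measurable_relOrder (α := Fin k → I × I) (f := fun m i => (m i).2) (fun i => by fun_prop)

theorem measurable_orderStat {k : ℕ} (h : Equiv.Perm (Fin k) → Equiv.Perm (Fin k) → ℝ) :
    Measurable (orderStat h) :=
  (measurable_of_countable fun p : Equiv.Perm (Fin k) × Equiv.Perm (Fin k) => h p.1 p.2).comp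
    (measurable_relOrder_fst.prodMk measurable_relOrder_snd)

theorem integrable_orderStat {k : ℕ} (h : Equiv.Perm (Fin k) → Equiv.Perm (Fin k) → ℝ)
    (P : Measure (Fin k → I × I)) [IsFiniteMeasure P] : Integrable (orderStat h) P :=
  (Integrable.of_finite
    (f := fun p : Equiv.Perm (Fin k) × Equiv.Perm (Fin k) => h p.1 p.2)).comp_measurable
    (measurable_relOrder_fst.prodMk measurable_relOrder_snd)

/-- The average over all relabelings of a function of relative orders, as a function of the
induced permutation. -/
noncomputable def symmetrization {k : ℕ} (h : Equiv.Perm (Fin k) → Equiv.Perm (Fin k) → ℝ)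
    (π : Equiv.Perm (Fin k)) : ℝ :=
  (k.factorial : ℝ)⁻¹ * ∑ τ : Equiv.Perm (Fin k), h (relOrder τ) (relOrder fun i => π (τ i))

/-- Up to relabelling, the points may be taken sorted by abscissa; then only the induced permutation
matters. -/
theorem sum_orderStat_comp_perm {k : ℕ} (h : Equiv.Perm (Fin k) → Equiv.Perm (Fin k) → ℝ)
    {m : Fin k → I × I} (hm : DistinctCoords m) :
    ∑ τ : Equiv.Perm (Fin k), orderStat h (fun i => m (τ i)) =
      ∑ τ : Equiv.Perm (Fin k), h (relOrder τ) (relOrder fun i => inducedPerm m (τ i)) := by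
  rw [← Equiv.sum_comp (Equiv.mulLeft (Tuple.sort fun i => (m i).1))]
  refine Finset.sum_congr rfl fun τ _ => ?_
  rw [relOrder_inducedPerm_comp hm]
  simp only [orderStat, Equiv.coe_mulLeft, Equiv.Perm.coe_mul, Function.comp_apply]
  congr 1
  exact relOrder_congr fun i j => (comp_sort_strictMono hm.1).lt_iff_lt

/-- Independent points are exchangeable, so a statistic may be averaged over all relabellings. -/
theorem integral_orderStat {k : ℕ} (h : Equiv.Perm (Fin k) → Equiv.Perm (Fin k) → ℝ)
    (ν : Permuton) :
    ∫ m, orderStat h m ∂iidKernel k ν = ∫ m, symmetrization h (inducedPerm m) ∂iidKernel k ν := by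
  have h1 : ∀ τ : Equiv.Perm (Fin k), ∫ m, orderStat h (fun i => m (τ i)) ∂iidKernel k ν =
      ∫ m, orderStat h m ∂iidKernel k ν := by
    intro τ
    nth_rw 2 [← iidKernel_map_comp ν τ.injective]
    rw [integral_map (measurable_pi_lambda _ fun i => measurable_pi_apply (τ i)).aemeasurable
      (measurable_orderStat h).aestronglyMeasurable]
  have h2 : (k.factorial : ℝ) ≠ 0 := by positivity
  calc ∫ m, orderStat h m ∂iidKernel k ν
      = (k.factorial : ℝ)⁻¹ * ∑ τ : Equiv.Perm (Fin k),
          ∫ m, orderStat h (fun i => m (τ i)) ∂iidKernel k ν := by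
        simp only [h1, Finset.sum_const, Finset.card_univ, Fintype.card_perm, Fintype.card_fin,
          nsmul_eq_mul]
        rw [inv_mul_cancel_left₀ h2]
    _ = ∫ m, (k.factorial : ℝ)⁻¹ * ∑ τ : Equiv.Perm (Fin k), orderStat h (fun i => m (τ i))
          ∂iidKernel k ν := by
        rw [integral_const_mul, integral_finsetSum]
        intro τ _
        have := integrable_orderStat h ((iidKernel k ν).map fun m i => m (τ i))
        exact this.comp_measurable (by fun_prop)
    _ = _ := by
        refine integral_congr_ae ?_
        filter_upwards [ae_distinctCoords k ν] with m hm
        rw [sum_orderStat_comp_perm h hm, symmetrization]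

theorem integral_comp_inducedPerm {k : ℕ} (H : Equiv.Perm (Fin k) → ℝ) (ν : Permuton) :
    ∫ m, H (inducedPerm m) ∂iidKernel k ν = ∑ π, (density π ν).toReal * H π := by
  rw [← integral_map (φ := inducedPerm) measurable_inducedPerm.aemeasurable
    (measurable_of_countable H).aestronglyMeasurable, integral_fintype Integrable.of_finite]
  refine Finset.sum_congr rfl fun π _ => ?_
  rw [map_measureReal_apply measurable_inducedPerm (measurableSet_singleton π), smul_eq_mul]
  rfl

/-- The juxtaposition of two functions of relative orders. -/
noncomputable def juxtapose {k l : ℕ} (op : ℝ → ℝ → ℝ)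
    (h₁ : Equiv.Perm (Fin k) → Equiv.Perm (Fin k) → ℝ)
    (h₂ : Equiv.Perm (Fin l) → Equiv.Perm (Fin l) → ℝ) (p q : Equiv.Perm (Fin (k + l))) : ℝ :=
  op (h₁ (relOrder fun i => p (Fin.castAdd l i)) (relOrder fun i => q (Fin.castAdd l i)))
    (h₂ (relOrder fun i => p (Fin.natAdd k i)) (relOrder fun i => q (Fin.natAdd k i)))

/-- The first `k` and last `l` points are independent blocks, and the order within a block is the
order of the ranks restricted to it. With `op` a sum or a product, this closes `orderAlgebra` under
the operation. -/
theorem integral_juxtapose {k l : ℕ} (op : ℝ → ℝ → ℝ)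
    (h₁ : Equiv.Perm (Fin k) → Equiv.Perm (Fin k) → ℝ)
    (h₂ : Equiv.Perm (Fin l) → Equiv.Perm (Fin l) → ℝ) (ν : Permuton) :
    ∫ m, orderStat (juxtapose op h₁ h₂) m ∂iidKernel (k + l) ν =
      ∫ p, op (orderStat h₁ p.1) (orderStat h₂ p.2) ∂((iidKernel k ν).prod (iidKernel l ν)) := by
  have hmap := prod_map_append ν.toMeasure k l
  simp only [← iidKernel_apply] at hmap
  have hae := ae_distinctCoords (k + l) ν
  rw [← hmap] at hae ⊢
  rw [integral_map measurable_append.aemeasurable (measurable_orderStat _).aestronglyMeasurable]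
  refine integral_congr_ae ?_
  filter_upwards [ae_of_ae_map measurable_append.aemeasurable hae] with p hp
  simp only [orderStat, juxtapose]
  rw [relOrder_relOrder_comp hp.1, relOrder_relOrder_comp hp.2, relOrder_relOrder_comp hp.1,
    relOrder_relOrder_comp hp.2]
  simp

open BoundedContinuousFunction in
/-- The algebra of the continuous functions of a permuton `ν` which are expectations of functions
of the relative orders of independent points with distribution `ν`. -/
noncomputable def orderAlgebra : StarSubalgebra ℝ (Permuton →ᵇ ℝ) where
  carrier := {F | ∃ (k : ℕ) (h : Equiv.Perm (Fin k) → Equiv.Perm (Fin k) → ℝ), ∀ ν,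
    F ν = ∫ m, orderStat h m ∂iidKernel k ν}
  mul_mem' := by
    rintro F G ⟨k, h₁, hF⟩ ⟨l, h₂, hG⟩
    refine ⟨k + l, juxtapose (· * ·) h₁ h₂, fun ν => ?_⟩
    rw [integral_juxtapose, integral_prod_mul, ← hF, ← hG]
    rfl
  add_mem' := by
    rintro F G ⟨k, h₁, hF⟩ ⟨l, h₂, hG⟩
    refine ⟨k + l, juxtapose (· + ·) h₁ h₂, fun ν => ?_⟩
    rw [integral_juxtapose, integral_add ((integrable_orderStat h₁ _).comp_fst _)
      ((integrable_orderStat h₂ _).comp_snd _), integral_fun_fst, integral_fun_snd, ← hF, ← hG]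
    simp
  algebraMap_mem' r := by
    refine ⟨0, fun _ _ => r, fun ν => ?_⟩
    simp [orderStat]
  star_mem' := by
    rintro F ⟨k, h, hF⟩
    exact ⟨k, h, fun ν => by simpa using hF ν⟩

theorem mem_orderAlgebra_iff {F : BoundedContinuousFunction Permuton ℝ} :
    F ∈ orderAlgebra ↔ ∃ (k : ℕ) (h : Equiv.Perm (Fin k) → Equiv.Perm (Fin k) → ℝ), ∀ ν,
      F ν = ∫ m, orderStat h m ∂iidKernel k ν := Iff.rfl

/-- The expectation of a function in the algebra only depends on the expected pattern
densities. -/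
theorem integral_eq_of_mem_orderAlgebra {F : BoundedContinuousFunction Permuton ℝ}
    (hF : F ∈ orderAlgebra) {Λ Λ' : Measure Permuton} [IsProbabilityMeasure Λ]
    [IsProbabilityMeasure Λ']
    (h : ∀ (k : ℕ) (π : Equiv.Perm (Fin k)), ∫⁻ ν, density π ν ∂Λ = ∫⁻ ν, density π ν ∂Λ') :
    ∫ ν, F ν ∂Λ = ∫ ν, F ν ∂Λ' := by
  obtain ⟨k, g, hg⟩ := mem_orderAlgebra_iff.1 hF
  have key : ∀ (M : Measure Permuton) [IsProbabilityMeasure M], ∫ ν, F ν ∂M =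
      ∑ π, (∫⁻ ν, density π ν ∂M).toReal * symmetrization g π := by
    intro M _
    simp only [hg, integral_orderStat, integral_comp_inducedPerm]
    rw [integral_finsetSum]
    · refine Finset.sum_congr rfl fun π _ => ?_
      rw [integral_mul_const, integral_toReal (measurable_density π).aemeasurable
        (ae_of_all _ fun ν => (density_le_one π ν).trans_lt ENNReal.one_lt_top)]
    · intro π _
      refine Integrable.mul_const ?_ _
      refine Integrable.of_bound (measurable_density π).ennreal_toReal.aestronglyMeasurable 1
        (ae_of_all _ fun ν => ?_)
      rw [Real.norm_of_nonneg ENNReal.toReal_nonneg]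
      exact ENNReal.toReal_le_of_le_ofReal zero_le_one (by simpa using density_le_one π ν)
  rw [key, key]
  simp only [h]

/-! ### Moments of a permuton -/

/-- Among the `a + b` last points, the first `a` ones are to the left of the initial point and the
other ones are below it. -/
def momentEvent (a b : ℕ) (p q : Equiv.Perm (Fin (a + b + 1))) : Prop :=
  (∀ i : Fin a, p (Fin.castAdd b i).succ < p 0) ∧ ∀ j : Fin b, q (Fin.natAdd a j).succ < q 0

theorem measure_fst_lt (ν : Permuton) (x : I) :
    ν.toMeasure {p | p.1 < x} = ENNReal.ofReal x := by
  have : {p : I × I | p.1 < x} = Prod.fst ⁻¹' Iio x := rfl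
  rw [this, ← Measure.map_apply measurable_fst measurableSet_Iio,
    show ν.toMeasure.map Prod.fst = volume from ν.2.1, unitInterval.volume_Iio]

theorem measure_snd_lt (ν : Permuton) (y : I) :
    ν.toMeasure {p | p.2 < y} = ENNReal.ofReal y := by
  have : {p : I × I | p.2 < y} = Prod.snd ⁻¹' Iio y := rfl
  rw [this, ← Measure.map_apply measurable_snd measurableSet_Iio,
    show ν.toMeasure.map Prod.snd = volume from ν.2.2, unitInterval.volume_Iio]

theorem measurableSet_orderEvent {k : ℕ} (p : Equiv.Perm (Fin k) → Equiv.Perm (Fin k) → Prop) :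
    MeasurableSet {m : Fin k → I × I |
      p (relOrder fun i => (m i).1) (relOrder fun i => (m i).2)} :=
  (measurable_relOrder_fst.prodMk measurable_relOrder_snd)
    (MeasurableSet.of_discrete (s := {z : Equiv.Perm (Fin k) × Equiv.Perm (Fin k) | p z.1 z.2}))

/-- Given the initial point `z`, the other points are independent; each is to its left with
probability `z.1` and below it with probability `z.2`, by uniformity of the marginals. -/
theorem iidKernel_momentEvent (a b : ℕ) (ν : Permuton) :
    iidKernel (a + b + 1) ν
      {m | momentEvent a b (relOrder fun i => (m i).1) (relOrder fun i => (m i).2)} =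
    ∫⁻ z, ENNReal.ofReal ((z.1 : ℝ) ^ a * (z.2 : ℝ) ^ b) ∂ν.toMeasure := by
  have hset : {m | momentEvent a b (relOrder fun i => (m i).1) (relOrder fun i => (m i).2)}
      =ᵐ[iidKernel (a + b + 1) ν] {m : Fin (a + b + 1) → I × I |
        (∀ i : Fin a, (m (Fin.castAdd b i).succ).1 < (m 0).1) ∧
          ∀ j : Fin b, (m (Fin.natAdd a j).succ).2 < (m 0).2} := by
    filter_upwards [ae_distinctCoords _ ν] with m hm
    refine propext ?_
    change momentEvent a b (relOrder fun i => (m i).1) (relOrder fun i => (m i).2) ↔ _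
    simp only [momentEvent, relOrder_lt_iff hm.1, relOrder_lt_iff hm.2]
    rfl
  have hmeas : MeasurableSet {m : Fin (a + b + 1) → I × I |
        (∀ i : Fin a, (m (Fin.castAdd b i).succ).1 < (m 0).1) ∧
          ∀ j : Fin b, (m (Fin.natAdd a j).succ).2 < (m 0).2} := by
    simp only [Set.ofPred_and, Set.ofPred_forall]
    exact .inter (.iInter fun i => measurableSet_lt (by fun_prop) (by fun_prop))
      (.iInter fun i => measurableSet_lt (by fun_prop) (by fun_prop))
  rw [measure_congr hset, iidKernel_apply, ← prod_map_cons, Measure.map_apply measurable_cons hmeas,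
    Measure.prod_apply (measurable_cons hmeas)]
  refine lintegral_congr fun z => ?_
  have : Prod.mk z ⁻¹' ((fun p : (I × I) × (Fin (a + b) → I × I) =>
      (Fin.cons p.1 p.2 : Fin (a + b + 1) → I × I)) ⁻¹' {m |
        (∀ i : Fin a, (m (Fin.castAdd b i).succ).1 < (m 0).1) ∧
          ∀ j : Fin b, (m (Fin.natAdd a j).succ).2 < (m 0).2}) =
      univ.pi (Fin.append (fun _ : Fin a => {p : I × I | p.1 < z.1})
        fun _ : Fin b => {p : I × I | p.2 < z.2}) := by
    ext m
    simp only [mem_preimage, mem_ofPred_eq, mem_univ_pi, Fin.forall_fin_add, Fin.append_left,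
      Fin.append_right, Fin.cons_succ, Fin.cons_zero]
  rw [this, Measure.pi_pi, Fin.prod_univ_add]
  simp only [Fin.append_left, Fin.append_right, measure_fst_lt, measure_snd_lt, Finset.prod_const,
    Finset.card_univ, Fintype.card_fin]
  rw [← ENNReal.ofReal_pow z.1.2.1, ← ENNReal.ofReal_pow z.2.2.1,
    ← ENNReal.ofReal_mul (pow_nonneg z.1.2.1 _)]

open BoundedContinuousFunction in
/-- The moment of exponents `a`, `b` of a permuton. -/
noncomputable def moment (a b : ℕ) : Permuton →ᵇ ℝ :=
  BoundedContinuousFunction.mkOfCompact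
    ⟨fun ν => (iidKernel (a + b + 1) ν {m | momentEvent a b (relOrder fun i => (m i).1)
      (relOrder fun i => (m i).2)}).toReal,
    ENNReal.continuousOn_toReal.comp_continuous
      (continuous_iidKernel_orderEvent (momentEvent a b)) fun _ => measure_ne_top _ _⟩

theorem moment_apply (a b : ℕ) (ν : Permuton) :
    moment a b ν = ∫ z, (z.1 : ℝ) ^ a * (z.2 : ℝ) ^ b ∂ν.toMeasure := by
  rw [integral_eq_lintegral_of_nonneg_ae (ae_of_all _ fun z => mul_nonneg
    (pow_nonneg z.1.2.1 _) (pow_nonneg z.2.2.1 _)) (by fun_prop), ← iidKernel_momentEvent]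
  rfl

theorem moment_mem_orderAlgebra (a b : ℕ) : moment a b ∈ orderAlgebra := by
  classical
  refine mem_orderAlgebra_iff.2 ⟨a + b + 1, fun p q => if momentEvent a b p q then 1 else 0,
    fun ν => ?_⟩
  have h : orderStat (fun p q => if momentEvent a b p q then (1 : ℝ) else 0) =
      {m : Fin (a + b + 1) → I × I | momentEvent a b (relOrder fun i => (m i).1)
        (relOrder fun i => (m i).2)}.indicator fun _ => 1 := by
    ext m
    simp only [orderStat, indicator_apply, mem_ofPred_eq]
  rw [h, integral_indicator_const _ (measurableSet_orderEvent _), smul_eq_mul, mul_one]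
  rfl

open BoundedContinuousFunction in
-- Polynomials in the two coordinates form an algebra separating the points of the square.
theorem measure_ext_of_moments {P P' : Measure (I × I)} [IsProbabilityMeasure P]
    [IsProbabilityMeasure P'] (h : ∀ a b : ℕ, ∫ z, (z.1 : ℝ) ^ a * (z.2 : ℝ) ^ b ∂P =
      ∫ z, (z.1 : ℝ) ^ a * (z.2 : ℝ) ^ b ∂P') : P = P' := by
  let X : (I × I) →ᵇ ℝ := .mkOfCompact ⟨fun z => (z.1 : ℝ), by fun_prop⟩
  let Y : (I × I) →ᵇ ℝ := .mkOfCompact ⟨fun z => (z.2 : ℝ), by fun_prop⟩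
  let A : StarSubalgebra ℝ ((I × I) →ᵇ ℝ) :=
    { Algebra.adjoin ℝ {X, Y} with
      star_mem' := fun {f} hf => by
        have : star f = f := by ext; simp
        rw [this]; exact hf }
  have hX : X ∈ A := Algebra.subset_adjoin (by simp)
  have hY : Y ∈ A := Algebra.subset_adjoin (by simp)
  refine ext_of_forall_mem_subalgebra_integral_eq_of_polish (𝕜 := ℝ) (A := A) ?_ ?_
  · intro z z' hz
    by_cases h1 : z.1 = z'.1
    · refine ⟨_, ⟨_, ⟨Y, hY, rfl⟩, rfl⟩, fun e => hz (Prod.ext h1 (Subtype.ext e))⟩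
    · exact ⟨_, ⟨_, ⟨X, hX, rfl⟩, rfl⟩, fun e => h1 (Subtype.ext e)⟩
  · have hint : ∀ (f : (I × I) →ᵇ ℝ) (M : Measure (I × I)) [IsProbabilityMeasure M],
        Integrable f M := fun f M _ => f.integrable M
    intro g hg
    -- The generated algebra is the span of the monomials, so linearity reduces the claim to
    -- moments.
    have hg' : g ∈ Submodule.span ℝ (Submonoid.closure {X, Y} : Set ((I × I) →ᵇ ℝ)) := by
      rw [← Algebra.adjoin_eq_span]
      exact hg
    clear hg
    induction hg' using Submodule.span_induction with
    | mem f hf =>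
      obtain ⟨a, b, rfl⟩ := (Submonoid.mem_closure_pair _ _ _).1 hf
      exact h a b
    | zero => simp
    | add f g _ _ hf hg =>
      simp only [BoundedContinuousFunction.coe_add, Pi.add_apply]
      rw [integral_add (hint f P) (hint g P), integral_add (hint f P') (hint g P'), hf, hg]
    | smul c f _ hf =>
      simp only [BoundedContinuousFunction.coe_smul, integral_smul, hf]

theorem ext_of_moment {ν ν' : Permuton} (h : ∀ a b, moment a b ν = moment a b ν') : ν = ν' := by
  refine Subtype.ext (Subtype.ext ?_)
  exact measure_ext_of_moments (P := ν.toMeasure) (P' := ν'.toMeasure)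
    fun a b => by rw [← moment_apply, ← moment_apply, h]

/-- The law of a random permuton is determined by its expected pattern densities. -/
theorem measure_ext_of_lintegral_density {Λ Λ' : Measure Permuton} [IsProbabilityMeasure Λ]
    [IsProbabilityMeasure Λ']
    (h : ∀ (k : ℕ) (π : Equiv.Perm (Fin k)), ∫⁻ ν, density π ν ∂Λ = ∫⁻ ν, density π ν ∂Λ') :
    Λ = Λ' := by
  refine ext_of_forall_mem_subalgebra_integral_eq_of_polish (𝕜 := ℝ) (A := orderAlgebra) ?_
    fun g hg => integral_eq_of_mem_orderAlgebra hg h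
  intro ν ν' hne
  obtain ⟨a, b, hab⟩ : ∃ a b, moment a b ν ≠ moment a b ν' := by
    by_contra! hc
    exact hne (ext_of_moment hc)
  exact ⟨_, ⟨_, ⟨moment a b, moment_mem_orderAlgebra a b, rfl⟩, rfl⟩, hab⟩

/-- A pattern density is a continuous function of the permuton. -/
theorem continuous_density {k : ℕ} (π : Equiv.Perm (Fin k)) : Continuous (density π) := by
  -- Since `p` is the order of the abscissas, `p.symm` lists the points from left to right; the
  -- induced permutation is `q` read in that order, almost surely.
  have h := continuous_iidKernel_orderEvent (k := k)
    fun p q => relOrder (fun i => q (p.symm i)) = π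
  convert h using 2 with ν
  refine measure_congr ?_
  filter_upwards [ae_distinctCoords k ν] with m hm
  refine propext ?_
  change inducedPerm m = π ↔
    relOrder (fun i => relOrder (fun i => (m i).2) ((relOrder fun i => (m i).1).symm i)) = π
  rw [relOrder_relOrder_comp hm.2]
  rfl

/-! ### Patterns in a permutation and in its permuton -/

/-- The proportion of the subsets of size `k` on which `τ` induces the pattern `π`. -/
noncomputable def patProportion {n k : ℕ} (π : Equiv.Perm (Fin k)) (τ : Equiv.Perm (Fin n)) :
    ℝ≥0∞ :=
  uniformOn (Set.univ : Set (Set.powersetCard (Fin n) k)) {J | pat J τ = π}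

theorem patProportion_eq {n k : ℕ} (π : Equiv.Perm (Fin k)) (τ : Equiv.Perm (Fin n)) :
    patProportion π τ = (∑ J : Set.powersetCard (Fin n) k, if pat J τ = π then 1 else 0) /
      Fintype.card (Set.powersetCard (Fin n) k) := by
  rw [patProportion, uniformOn_univ, ← lintegral_indicator_one MeasurableSet.of_discrete,
    lintegral_count, tsum_fintype]
  simp [indicator_apply]

/-- Clears the denominator, as there are `k!` injections per subset. When `k > n` there are no
subsets and both sides vanish. -/
theorem descFactorial_mul_patProportion {n k : ℕ} (π : Equiv.Perm (Fin k))
    (τ : Equiv.Perm (Fin n)) : (n.descFactorial k : ℝ≥0∞) * patProportion π τ =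
      k.factorial * ∑ J : Set.powersetCard (Fin n) k, if pat J τ = π then 1 else 0 := by
  rw [patProportion_eq, card_embedding_eq]
  rcases isEmpty_or_nonempty (Set.powersetCard (Fin n) k) with h | h
  · simp
  · push_cast
    rw [mul_comm (Fintype.card _ : ℝ≥0∞), mul_assoc,
      ENNReal.mul_div_cancel (Nat.cast_ne_zero.2 Fintype.card_ne_zero) (ENNReal.natCast_ne_top _)]

/-- Choosing `n` points and then a uniform subset of `k` of them amounts to choosing `k` points. -/
theorem lintegral_patProportion {n k : ℕ} (hkn : k ≤ n) (π : Equiv.Perm (Fin k)) (ν : Permuton) :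
    ∫⁻ m, patProportion π (inducedPerm m) ∂iidKernel n ν = density π ν := by
  have h0 : (n.descFactorial k : ℝ≥0∞) ≠ 0 := by
    simpa [Nat.descFactorial_eq_zero_iff_lt] using hkn
  rw [← ENNReal.mul_right_inj h0 (by simp),
    ← lintegral_const_mul (f := fun m => patProportion π (inducedPerm m)) _
      ((measurable_of_countable (patProportion π)).comp measurable_inducedPerm)]
  have h1 : ∀ e : Fin k ↪ Fin n, density π ν =
      ∫⁻ m, ({π} : Set (Equiv.Perm (Fin k))).indicator 1 (inducedPerm fun i => m (e i))
        ∂iidKernel n ν := by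
    intro e
    have he : Measurable fun (m : Fin n → I × I) (i : Fin k) => m (e i) :=
      measurable_pi_lambda _ fun i => measurable_pi_apply (e i)
    rw [density, ← iidKernel_map_comp ν e.injective, Measure.map_apply he
      (measurableSet_inducedPerm_eq π), ← lintegral_indicator_one
      (he (measurableSet_inducedPerm_eq π))]
    rfl
  have h2 : (n.descFactorial k : ℝ≥0∞) * density π ν = ∑ e : Fin k ↪ Fin n, density π ν := by
    simp [Fintype.card_embedding_eq]
  rw [h2, Finset.sum_congr rfl fun e _ => h1 e, ← lintegral_finsetSum]
  · refine lintegral_congr_ae ?_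
    filter_upwards [ae_distinctCoords n ν] with m hm
    set s := Tuple.sort fun j => (m j).1
    -- Composing the injections with `s` makes `J` a set of positions in the left-to-right order;
    -- all `k!` labellings of `J` then induce the same pattern.
    rw [descFactorial_mul_patProportion, ← Equiv.sum_comp (Equiv.embeddingCongr (Equiv.refl _) s),
      sum_embedding_eq, Finset.mul_sum]
    refine Finset.sum_congr rfl fun J _ => ?_
    have hJ : ∀ τ : Equiv.Perm (Fin k), inducedPerm (fun i =>
        m (Equiv.embeddingCongr (Equiv.refl _) s (labelledEmb (J, τ)) i)) =
          pat J (inducedPerm m) := by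
      intro τ
      rw [pat_inducedPerm hm]
      exact inducedPerm_comp_perm
        (hm.comp (s.injective.comp (Finset.orderEmbOfFin J.1 J.2).injective)) τ
    simp only [hJ, indicator_apply, mem_singleton_iff, Finset.sum_const, Finset.card_univ,
      Fintype.card_perm, Fintype.card_fin, nsmul_eq_mul, Pi.one_apply]
  · intro e _
    exact ((measurable_of_countable (({π} : Set (Equiv.Perm (Fin k))).indicator 1)).comp
      measurable_inducedPerm).comp (measurable_pi_lambda _ fun i => measurable_pi_apply (e i))

/-! ### Cells of the permuton of a permutation -/

theorem permMeasure_strip_prod {n : ℕ} (τ : Equiv.Perm (Fin n)) (i : Fin n) :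
    permMeasure τ (strip n i ×ˢ strip n (τ i)) = (n : ℝ≥0∞)⁻¹ := by
  have hn : (n : ℝ≥0∞) ≠ 0 := by simpa using i.pos.ne'
  rw [permMeasure_prod τ (measurableSet_strip n i) (measurableSet_strip n _),
    Finset.sum_eq_single i]
  · rw [inter_self, inter_self, volume_strip, volume_strip, ← mul_assoc,
      ENNReal.mul_inv_cancel hn (by simp), one_mul]
  · intro j _ hj
    rw [(disjoint_strip hj).inter_eq]
    simp
  · simp

theorem lt_of_mem_strip {n : ℕ} {i j : Fin n} (hij : i < j) {x y : I} (hx : x ∈ strip n i)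
    (hy : y ∈ strip n j) : x < y := by
  by_contra! h
  have h1 : ⌈(n : ℝ) * (y : ℝ)⌉₊ ≤ ⌈(n : ℝ) * (x : ℝ)⌉₊ :=
    Nat.ceil_mono (mul_le_mul_of_nonneg_left h n.cast_nonneg)
  simp only [strip, mem_ofPred_eq] at hx hy
  have : (i : ℕ) < j := hij
  omega

theorem lt_iff_of_mem_strip {n : ℕ} {i j : Fin n} (hne : i ≠ j) {x y : I} (hx : x ∈ strip n i)
    (hy : y ∈ strip n j) : x < y ↔ i < j := by
  refine ⟨fun h => ?_, fun h => lt_of_mem_strip h hx hy⟩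
  by_contra hc
  exact (lt_of_mem_strip (lt_of_le_of_ne (not_lt.1 hc) hne.symm) hy hx).not_gt h

/-- The set of the `k`-tuples of points whose `i`-th point belongs to the cell of `e i` in the
support of the permuton of `σ`. -/
def cells {n k : ℕ} (s : Equiv.Perm (Fin n)) (e : Fin k → Fin n) : Set (Fin k → I × I) :=
  univ.pi fun i => strip n (e i) ×ˢ strip n (s (e i))

theorem lt_iff_of_mem_cells {n k : ℕ} {s : Equiv.Perm (Fin n)} {e : Fin k → Fin n}
    (he : Function.Injective e) {m : Fin k → I × I} (hm : m ∈ cells s e) (i j : Fin k) :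
    ((m i).1 < (m j).1 ↔ e i < e j) ∧ ((m i).2 < (m j).2 ↔ s (e i) < s (e j)) := by
  rcases eq_or_ne i j with rfl | hij
  · simp
  · have hi := hm i (mem_univ i)
    have hj := hm j (mem_univ j)
    exact ⟨lt_iff_of_mem_strip (he.ne hij) hi.1 hj.1,
      lt_iff_of_mem_strip (s.injective.ne (he.ne hij)) hi.2 hj.2⟩

theorem inducedPerm_of_mem_cells {n k : ℕ} {s : Equiv.Perm (Fin n)}
    {p : Set.powersetCard (Fin n) k × Equiv.Perm (Fin k)} {m : Fin k → I × I}
    (hm : m ∈ cells s (labelledEmb p)) : inducedPerm m = pat p.1 s := by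
  obtain ⟨J, τ⟩ := p
  have hlt := lt_iff_of_mem_cells (labelledEmb (J, τ)).injective hm
  have hd : DistinctCoords m := by
    constructor
    · intro i j hij
      by_contra hne
      rcases lt_or_gt_of_ne ((labelledEmb (J, τ)).injective.ne hne) with h | h
      · exact ((hlt _ _).1.2 h).ne hij
      · exact ((hlt _ _).1.2 h).ne' hij
    · intro i j hij
      by_contra hne
      rcases lt_or_gt_of_ne (s.injective.ne ((labelledEmb (J, τ)).injective.ne hne)) with h | h
      · exact ((hlt _ _).2.2 h).ne hij
      · exact ((hlt _ _).2.2 h).ne' hij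
  -- Undoing the labelling `τ` lists the points by increasing abscissa.
  rw [← inducedPerm_comp_perm hd τ.symm, inducedPerm_of_strictMono]
  · exact relOrder_congr fun i j => by simpa using (hlt (τ.symm i) (τ.symm j)).2
  · intro i j hij
    refine (hlt (τ.symm i) (τ.symm j)).1.2 ?_
    simpa using hij

theorem iidKernel_cells {n k : ℕ} [NeZero n] (s : Equiv.Perm (Fin n)) (e : Fin k → Fin n) :
    iidKernel k (ofPerm s) (cells s e) = ((n : ℝ≥0∞)⁻¹) ^ k := by
  rw [iidKernel_apply, cells, Measure.pi_pi]
  have : ∀ i, (ofPerm s).toMeasure (strip n (e i) ×ˢ strip n (s (e i))) = (n : ℝ≥0∞)⁻¹ :=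
    fun i => permMeasure_strip_prod s (e i)
  simp [this]

theorem disjoint_cells {n k : ℕ} (s : Equiv.Perm (Fin n)) {e e' : Fin k → Fin n} (h : e ≠ e') :
    Disjoint (cells s e) (cells s e') := by
  obtain ⟨i, hi⟩ := Function.ne_iff.1 h
  rw [Set.disjoint_left]
  intro m hm hm'
  exact Set.disjoint_left.1 (disjoint_strip hi) (hm i (mem_univ i)).1 (hm' i (mem_univ i)).1

theorem measurableSet_cells {n k : ℕ} (s : Equiv.Perm (Fin n)) (e : Fin k → Fin n) :
    MeasurableSet (cells s e) :=
  .univ_pi fun _ => (measurableSet_strip n _).prod (measurableSet_strip n _)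

/-- The pattern densities of the permuton of `s` are almost bounded below by those of `s`. -/
theorem mul_patProportion_le_density {n k : ℕ} [NeZero n] (π : Equiv.Perm (Fin k))
    (s : Equiv.Perm (Fin n)) :
    (n.descFactorial k : ℝ≥0∞) * ((n : ℝ≥0∞)⁻¹) ^ k * patProportion π s ≤
      density π (ofPerm s) := by
  rw [mul_right_comm, descFactorial_mul_patProportion]
  have hcount : (k.factorial : ℝ≥0∞) *
      ∑ J : Set.powersetCard (Fin n) k, (if pat J s = π then 1 else 0) =
      ∑ p : Set.powersetCard (Fin n) k × Equiv.Perm (Fin k), if pat p.1 s = π then 1 else 0 := by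
    rw [Fintype.sum_prod_type, Finset.mul_sum]
    refine Finset.sum_congr rfl fun J _ => ?_
    by_cases hJ : pat J s = π <;> simp [hJ, Fintype.card_perm]
  rw [hcount, Finset.sum_mul]
  calc ∑ p : Set.powersetCard (Fin n) k × Equiv.Perm (Fin k),
        (if pat p.1 s = π then 1 else 0) * ((n : ℝ≥0∞)⁻¹) ^ k
      = ∑ p ∈ Finset.univ.filter
          (fun p : Set.powersetCard (Fin n) k × Equiv.Perm (Fin k) => pat p.1 s = π),
          iidKernel k (ofPerm s) (cells s (labelledEmb p)) := by
        simp only [iidKernel_cells, Finset.sum_filter, ite_mul, one_mul, zero_mul]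
    _ = iidKernel k (ofPerm s) (⋃ p ∈ Finset.univ.filter
          (fun p : Set.powersetCard (Fin n) k × Equiv.Perm (Fin k) => pat p.1 s = π),
          cells s (labelledEmb p)) := by
        rw [measure_biUnion_finset _ fun p _ => measurableSet_cells s _]
        intro p _ q _ hpq
        exact disjoint_cells s fun h => hpq (labelledEmb_bijective.1 (DFunLike.coe_injective h))
    -- Tuples with two points in the same cell are discarded, whence only an inequality.
    _ ≤ density π (ofPerm s) := by
        refine measure_mono (iUnion₂_subset fun p hp m hm => ?_)
        rw [Finset.mem_filter] at hp
        exact (inducedPerm_of_mem_cells hm).trans hp.2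

/-- The factor is the probability that `k` points sampled from the permuton of a permutation of size
`n` fall in distinct cells. -/
theorem tendsto_descFactorial_mul_inv_pow (k : ℕ) :
    Tendsto (fun n : ℕ => (n.descFactorial k : ℝ≥0∞) * ((n : ℝ≥0∞)⁻¹) ^ k) atTop (𝓝 1) := by
  have hz : ∀ᶠ n : ℕ in atTop, ((n : ℝ) ^ k) ≠ 0 :=
    (eventually_ne_atTop 0).mono fun n hn => pow_ne_zero _ (Nat.cast_ne_zero.2 hn)
  have h := (Asymptotics.isEquivalent_iff_tendsto_one hz).1 (isEquivalent_descFactorial k)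
  have h' := ENNReal.tendsto_ofReal h
  rw [ENNReal.ofReal_one] at h'
  refine h'.congr' ((eventually_gt_atTop 0).mono fun n hn => ?_)
  have hn' : (0 : ℝ) < n := Nat.cast_pos.2 hn
  simp only [Pi.div_apply]
  rw [ENNReal.ofReal_div_of_pos (by positivity), ENNReal.ofReal_pow hn'.le, ENNReal.ofReal_natCast,
    ENNReal.ofReal_natCast, div_eq_mul_inv, ENNReal.inv_pow]

end Permuton

/-! ### Random permutations -/

theorem measurable_inducedPerm_snd {α : Type*} [MeasurableSpace α] {k : ℕ} :
    Measurable fun q : α × (Fin k → I × I) => inducedPerm q.2 :=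
  measurable_inducedPerm.comp measurable_snd

theorem identDistrib_perm_iff {k : ℕ} {Ω Ω' : Type*} [MeasurableSpace Ω] [MeasurableSpace Ω']
    {P : Measure Ω} {P' : Measure Ω'} {X : Ω → Equiv.Perm (Fin k)} {X' : Ω' → Equiv.Perm (Fin k)}
    (hX : Measurable X) (hX' : Measurable X') :
    IdentDistrib X X' P P' ↔ ∀ π, P (X ⁻¹' {π}) = P' (X' ⁻¹' {π}) := by
  constructor
  · exact fun h π => h.measure_preimage_eq (measurableSet_singleton π)
  · intro h
    refine ⟨hX.aemeasurable, hX'.aemeasurable, Measure.ext_of_singleton fun π => ?_⟩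
    rw [Measure.map_apply hX (measurableSet_singleton π),
      Measure.map_apply hX' (measurableSet_singleton π), h]

namespace Permuton

theorem sampleLaw_preimage {Ω : Type*} [MeasurableSpace Ω] (Q : Measure Ω)
    [IsProbabilityMeasure Q] (μ : Ω → Permuton) {k : ℕ} (π : Equiv.Perm (Fin k)) :
    sampleLaw Q μ k ((fun q => inducedPerm q.2) ⁻¹' {π}) = ∫⁻ ν, density π ν ∂Q.map μ := by
  rw [sampleLaw, Measure.compProd_apply
    (measurable_inducedPerm_snd (measurableSet_singleton π))]
  rfl

theorem lintegral_patProportion_sampleLaw {Ω : Type*} [MeasurableSpace Ω] (Q : Measure Ω)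
    [IsProbabilityMeasure Q] (μ : Ω → Permuton) {n k : ℕ} (hkn : k ≤ n)
    (π : Equiv.Perm (Fin k)) :
    ∫⁻ q, patProportion π (inducedPerm q.2) ∂sampleLaw Q μ n = ∫⁻ ν, density π ν ∂Q.map μ := by
  rw [sampleLaw, Measure.lintegral_compProd]
  · simp only [lintegral_patProportion hkn]
  · exact (measurable_of_countable (patProportion π)).comp measurable_inducedPerm_snd

end Permuton

section families

variable {Ω : ℕ+ → Type v} [∀ n, MeasurableSpace (Ω n)] {P : ∀ n, Measure (Ω n)}
  {ρ : ∀ n : ℕ+, Ω n → Equiv.Perm (Fin n)}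

theorem isSampledFamily_iff {Ω' : Type*} [MeasurableSpace Ω'] {Q : Measure Ω'}
    [IsProbabilityMeasure Q] {μ : Ω' → Permuton} (hρ : ∀ n, Measurable (ρ n)) :
    IsSampledFamily Q μ P ρ ↔ ∀ (k : ℕ+) (π : Equiv.Perm (Fin k)),
      ∫⁻ ν, Permuton.density π ν ∂Q.map μ = P k (ρ k ⁻¹' {π}) := by
  refine forall_congr' fun k => ?_
  rw [identDistrib_perm_iff measurable_inducedPerm_snd (hρ k)]
  simp only [Permuton.sampleLaw_preimage]

variable [∀ n, IsProbabilityMeasure (P n)]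

theorem measurable_pat_uncurry {n k : ℕ} {α : Type*} [MeasurableSpace α]
    {X : α → Equiv.Perm (Fin n)} (hX : Measurable X) :
    Measurable fun q : Set.powersetCard (Fin n) k × α => pat q.1 (X q.2) :=
  measurable_from_prod_countable_right fun J =>
    (measurable_of_countable fun τ : Equiv.Perm (Fin n) => pat J τ).comp hX

theorem prod_uniformOn_preimage {n k : ℕ} {α : Type*} [MeasurableSpace α] (M : Measure α)
    [IsProbabilityMeasure M] {X : α → Equiv.Perm (Fin n)} (hX : Measurable X)
    (π : Equiv.Perm (Fin k)) :
    (uniformOn (Set.univ : Set (Set.powersetCard (Fin n) k))).prod M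
      ((fun q => pat q.1 (X q.2)) ⁻¹' {π}) = ∫⁻ ω, Permuton.patProportion π (X ω) ∂M := by
  rw [Measure.prod_apply_symm (measurable_pat_uncurry hX (measurableSet_singleton π))]
  rfl

theorem isConsistentFamily_iff (hρ : ∀ n, Measurable (ρ n)) :
    IsConsistentFamily P ρ ↔ ∀ n k : ℕ+, k ≤ n → ∀ π : Equiv.Perm (Fin k),
      ∫⁻ ω, Permuton.patProportion π (ρ n ω) ∂P n = P k (ρ k ⁻¹' {π}) := by
  refine forall_congr' fun n => forall_congr' fun k => imp_congr_right fun _ => ?_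
  rw [identDistrib_perm_iff (measurable_pat_uncurry (hρ n)) (hρ k)]
  simp only [prod_uniformOn_preimage _ (hρ n)]

/-- The expected proportion of `π` in a sampled permutation of size `n ≥ k` is the expected density
of `π`, whatever `n`. -/
theorem IsSampledFamily.isConsistentFamily {Ω' : Type*} [MeasurableSpace Ω'] {Q : Measure Ω'}
    [IsProbabilityMeasure Q] {μ : Ω' → Permuton} (hρ : ∀ n, Measurable (ρ n))
    (h : IsSampledFamily Q μ P ρ) : IsConsistentFamily P ρ := by
  refine (isConsistentFamily_iff hρ).2 fun n k hkn π => ?_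
  rw [← (isSampledFamily_iff hρ).1 h k π,
    ← Permuton.lintegral_patProportion_sampleLaw Q μ (show (k : ℕ) ≤ n from hkn) π]
  exact (((h n).comp (measurable_of_countable (Permuton.patProportion π))).lintegral_eq).symm

theorem Permuton.lintegral_density_of_subsingleton {Λ : Measure Permuton} [IsProbabilityMeasure Λ]
    (π : Equiv.Perm (Fin 0)) : ∫⁻ ν, Permuton.density π ν ∂Λ = 1 := by
  have : ∀ ν, Permuton.density π ν = 1 := fun ν => by
    rw [← Permuton.sum_density (k := 0) ν, Fintype.sum_unique, Subsingleton.elim π default]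
  simp [this]

/-- Families start at size `1`, whereas `orderAlgebra` also uses size `0`; there the only density is
the constant `1`. -/
theorem Permuton.measure_eq_of_density {Λ Λ' : Measure Permuton} [IsProbabilityMeasure Λ]
    [IsProbabilityMeasure Λ']
    (h : ∀ (k : ℕ+) (π : Equiv.Perm (Fin k)),
      ∫⁻ ν, Permuton.density π ν ∂Λ = ∫⁻ ν, Permuton.density π ν ∂Λ') : Λ = Λ' := by
  refine Permuton.measure_ext_of_lintegral_density fun k => ?_
  rcases Nat.eq_zero_or_pos k with rfl | hk
  · intro π
    simp only [Permuton.lintegral_density_of_subsingleton]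
  · exact h ⟨k, hk⟩

/-! ### Limits of the laws of the permutons of a family -/

theorem Permuton.measurable_ofPerm (hρ : ∀ n, Measurable (ρ n)) (n : ℕ+) :
    Measurable fun ω => Permuton.ofPerm (ρ n ω) :=
  (measurable_of_countable Permuton.ofPerm).comp (hρ n)

/-- The law of the permuton of the `n`-th term of a family of random permutations. -/
noncomputable def Permuton.familyLaw (P : ∀ n, Measure (Ω n)) [∀ n, IsProbabilityMeasure (P n)]
    (ρ : ∀ n : ℕ+, Ω n → Equiv.Perm (Fin n)) (hρ : ∀ n, Measurable (ρ n)) (n : ℕ+) :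
    ProbabilityMeasure Permuton :=
  ⟨(P n).map fun ω => Permuton.ofPerm (ρ n ω),
    Measure.isProbabilityMeasure_map (Permuton.measurable_ofPerm hρ n).aemeasurable⟩

/-- Every limit of the laws of the permutons of a consistent family has the expected pattern
densities. -/
theorem IsConsistentFamily.lintegral_density_eq (hρ : ∀ n, Measurable (ρ n))
    (h : IsConsistentFamily P ρ) {l : Filter ℕ+} [l.NeBot] (hl : l ≤ atTop)
    {Λ : ProbabilityMeasure Permuton} (hΛ : Tendsto (Permuton.familyLaw P ρ hρ) l (𝓝 Λ))
    (k : ℕ+) (π : Equiv.Perm (Fin k)) :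
    ∫⁻ ν, Permuton.density π ν ∂(Λ : Measure Permuton) = P k (ρ k ⁻¹' {π}) := by
  have hle : ∀ π : Equiv.Perm (Fin k),
      P k (ρ k ⁻¹' {π}) ≤ ∫⁻ ν, Permuton.density π ν ∂(Λ : Measure Permuton) := by
    intro π
    have hfin : ∀ ν, Permuton.density π ν ≠ ∞ := fun ν => measure_ne_top _ _
    let f : BoundedContinuousFunction Permuton NNReal := .mkOfCompact
      ⟨fun ν => (Permuton.density π ν).toNNReal, continuous_iff_continuousAt.2 fun ν =>
        (ENNReal.tendsto_toNNReal (hfin ν)).comp (Permuton.continuous_density π).continuousAt⟩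
    have hf : ∀ ν, (f ν : ℝ≥0∞) = Permuton.density π ν := fun ν => ENNReal.coe_toNNReal (hfin ν)
    have h1 := (ProbabilityMeasure.tendsto_iff_forall_lintegral_tendsto.1 hΛ) f
    simp only [hf] at h1
    have h2 : Tendsto (fun n : ℕ+ => ((n : ℕ).descFactorial k : ℝ≥0∞) *
        (((n : ℕ) : ℝ≥0∞)⁻¹) ^ (k : ℕ) * P k (ρ k ⁻¹' {π})) l (𝓝 (1 * P k (ρ k ⁻¹' {π}))) :=
      ENNReal.Tendsto.mul_const (((Permuton.tendsto_descFactorial_mul_inv_pow k).comp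
        tendsto_PNat_val_atTop_atTop).mono_left hl) (Or.inr (measure_ne_top _ _))
    rw [one_mul] at h2
    refine le_of_tendsto_of_tendsto h2 h1 (((eventually_ge_atTop k).filter_mono hl).mono fun n hn => ?_)
    change ((n : ℕ).descFactorial k : ℝ≥0∞) * (((n : ℕ) : ℝ≥0∞)⁻¹) ^ (k : ℕ) *
      P k (ρ k ⁻¹' {π}) ≤ ∫⁻ ν, Permuton.density π ν ∂(P n).map fun ω => Permuton.ofPerm (ρ n ω)
    rw [lintegral_map (Permuton.measurable_density π) (Permuton.measurable_ofPerm hρ n),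
      ← (isConsistentFamily_iff hρ).1 h n k hn π, ← lintegral_const_mul
        (f := fun ω => Permuton.patProportion π (ρ n ω)) _
        ((measurable_of_countable (Permuton.patProportion π)).comp (hρ n))]
    exact lintegral_mono fun ω => Permuton.mul_patProportion_le_density π (ρ n ω)
  -- Both sides equal `1`; finite sums that are equal and compare termwise have equal terms.
  have hsum : ∑ π : Equiv.Perm (Fin k), P k (ρ k ⁻¹' {π}) =
      ∑ π : Equiv.Perm (Fin k), ∫⁻ ν, Permuton.density π ν ∂(Λ : Measure Permuton) := by
    rw [← lintegral_finsetSum _ fun π _ => Permuton.measurable_density π]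
    simp only [Permuton.sum_density, lintegral_one, measure_univ]
    have := sum_measure_preimage_singleton (μ := P k) (f := ρ k) Finset.univ
      fun π _ => hρ k (measurableSet_singleton π)
    simpa using this
  refine le_antisymm ?_ (hle π)
  rw [← Finset.sum_erase_add _ _ (Finset.mem_univ π),
    ← Finset.sum_erase_add (f := fun π => ∫⁻ ν, Permuton.density π ν ∂(Λ : Measure Permuton)) _
      (Finset.mem_univ π)] at hsum
  have hrest : ∑ τ ∈ Finset.univ.erase π, P k (ρ k ⁻¹' {τ}) ≠ ∞ := by
    simp [ENNReal.sum_eq_top, measure_ne_top]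
  rw [← ENNReal.add_le_add_iff_left hrest, hsum]
  gcongr with τ
  exact hle τ

/-- The laws on the compact metrizable space of permutons form a compact space. -/
theorem IsConsistentFamily.exists_tendsto (hρ : ∀ n, Measurable (ρ n))
    (l : Ultrafilter ℕ+) : ∃ Λ : ProbabilityMeasure Permuton,
      Tendsto (Permuton.familyLaw P ρ hρ) l (𝓝 Λ) := by
  obtain ⟨Λ, -, hΛ⟩ := isCompact_univ.ultrafilter_le_nhds
    (l.map (Permuton.familyLaw P ρ hρ)) (by simp)
  exact ⟨Λ, hΛ⟩

end families

theorem mainTheorem3 :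
    -- the sampled subpermutations of a random permuton form a consistent family
    (∀ (Ω' : Type u) [MeasurableSpace Ω'] (Q : Measure Ω') [IsProbabilityMeasure Q]
        (μ : Ω' → Permuton), Measurable μ →
      ∀ (Ω : ℕ+ → Type v) [∀ n, MeasurableSpace (Ω n)] (P : ∀ n, Measure (Ω n))
        [∀ n, IsProbabilityMeasure (P n)] (ρ : ∀ n : ℕ+, Ω n → Equiv.Perm (Fin n)),
        (∀ n, Measurable (ρ n)) → IsSampledFamily Q μ P ρ → IsConsistentFamily P ρ) ∧
    -- conversely, let `ρ` be a consistent family of random permutations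
    (∀ (Ω : ℕ+ → Type v) [∀ n, MeasurableSpace (Ω n)] (P : ∀ n, Measure (Ω n))
        [∀ n, IsProbabilityMeasure (P n)] (ρ : ∀ n : ℕ+, Ω n → Equiv.Perm (Fin n)),
        (∀ n, Measurable (ρ n)) → IsConsistentFamily P ρ →
      -- existence of the random permuton
      (∃ (Ω' : Type) (_ : MeasurableSpace Ω') (Q : Measure Ω') (_ : IsProbabilityMeasure Q)
        (μ : Ω' → Permuton), Measurable μ ∧ IsSampledFamily Q μ P ρ) ∧
      -- uniqueness of its distribution
      (∀ (Ω₁ : Type u) [MeasurableSpace Ω₁] (Q₁ : Measure Ω₁) [IsProbabilityMeasure Q₁]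
        (μ₁ : Ω₁ → Permuton) (Ω₂ : Type w) [MeasurableSpace Ω₂] (Q₂ : Measure Ω₂)
        [IsProbabilityMeasure Q₂] (μ₂ : Ω₂ → Permuton), Measurable μ₁ → Measurable μ₂ →
        IsSampledFamily Q₁ μ₁ P ρ → IsSampledFamily Q₂ μ₂ P ρ → IdentDistrib μ₁ μ₂ Q₁ Q₂) ∧
      -- convergence in distribution to it
      (∀ (Ω' : Type u) [MeasurableSpace Ω'] (Q : Measure Ω') [IsProbabilityMeasure Q]
        (μ : Ω' → Permuton), Measurable μ → IsSampledFamily Q μ P ρ →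
        TendstoInDistribution (fun (n : ℕ+) (ω : Ω n) => Permuton.ofPerm (ρ n ω)) atTop μ P Q)) := by
  refine ⟨fun Ω' _ Q _ μ _ Ω _ P _ ρ hρ h => h.isConsistentFamily hρ,
    fun Ω _ P _ ρ hρ hc => ⟨?_, ?_, ?_⟩⟩
  · obtain ⟨Λ, hΛ⟩ := IsConsistentFamily.exists_tendsto (P := P) hρ (Ultrafilter.of atTop)
    -- The random permuton is the identity on the space of permutons equipped with a limit law.
    refine ⟨Permuton, inferInstance, Λ, inferInstance, id, measurable_id,
      (isSampledFamily_iff hρ).2 fun k π => ?_⟩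
    rw [Measure.map_id]
    exact hc.lintegral_density_eq hρ (Ultrafilter.of_le _) hΛ k π
  · intro Ω₁ _ Q₁ _ μ₁ Ω₂ _ Q₂ _ μ₂ hμ₁ hμ₂ h₁ h₂
    have := Measure.isProbabilityMeasure_map (μ := Q₁) hμ₁.aemeasurable
    have := Measure.isProbabilityMeasure_map (μ := Q₂) hμ₂.aemeasurable
    refine ⟨hμ₁.aemeasurable, hμ₂.aemeasurable, Permuton.measure_eq_of_density fun k π => ?_⟩
    rw [(isSampledFamily_iff hρ).1 h₁, (isSampledFamily_iff hρ).1 h₂]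
  · intro Ω' _ Q _ μ hμ h
    refine ⟨fun n => (Permuton.measurable_ofPerm hρ n).aemeasurable, hμ.aemeasurable, ?_⟩
    change Tendsto (Permuton.familyLaw P ρ hρ) atTop _
    -- Each ultrafilter finer than `atTop` yields some limit law, and its expected densities force
    -- it to be the law of `μ`.
    rw [tendsto_iff_ultrafilter]
    intro l hl
    obtain ⟨Λ, hΛ⟩ := IsConsistentFamily.exists_tendsto (P := P) hρ l
    have := Measure.isProbabilityMeasure_map (μ := Q) hμ.aemeasurable
    have hlim : (⟨Q.map μ, this⟩ : ProbabilityMeasure Permuton) = Λ := by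
      refine Subtype.ext (Permuton.measure_eq_of_density (Λ := Q.map μ)
        (Λ' := (Λ : Measure Permuton)) fun k π => ?_)
      rw [(isSampledFamily_iff hρ).1 h, hc.lintegral_density_eq hρ hl hΛ]
    rw [hlim]
    exact hΛ
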